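/- **Setting.** A state of nature $\theta\in\{H,L\}$ has prior $\Pr(\theta=H)=p\in(0,1)$ and is observed by the sender only. Signals come from a finite set $S$ and are i.i.d. given $\theta$, with $\pi_\theta(s)>0$ for all $\theta,s$ and $\pi_H\neq\pi_L$. A *protocol* of the receiver with $m\ge 2$ memory states $M=\{1,\dots,m\}$ is a triple $\Pi=(f,g,a)$ of a transition function $f:M\times S\to\Delta(M)$, an initial distribution $g\in\Delta(M)$ and an action rule $a:M\to[0,1]$. A memory state $i$ is absorbing if $f(i,s)(i)=1$ for all $s$. Knowing $\Pi$, the sender chooses $\sigma:M\times\{H,L\}\to[0,1]$, the probability of stopping in each memory state and state of nature. In each period, the game ends if the memory state is absorbing or the sender stops; otherwise a signal $s$ is drawn from $\pi_\theta$ and the memory state moves from $i$ to $j$ with probability $f(i,s)(j)$. When the game ends in memory state $i$, action $H$ is taken with probability $a(i)$ and action $L$ otherwise. The sender gets $1$ if the action is $H$ and $0$ if it is $L$; the receiver gets $1$ if the action equals $\theta$ and $0$ otherwise; both get $0$ if the game never ends. Let $U^S(\Pi)$ and $U^R(\Pi)$ be the expected payoffs when the sender plays a best response to $\Pi$ (one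 that maximizes her expected payoff; the receiver's optimal payoff $\sup_\Pi U^R(\Pi)$ is the supremum over all protocols with $m$ states and all best responses to them). A protocol is *parsimonious* if it has two absorbing memory states, with $a=0$ at one and $a=1$ at the other, and all other memory states are transient with $a=0$. Put $$\gamma=\frac{\max_{s}\pi_H(s)/\pi_L(s)}{\min_{s}\pi_H(s)/\pi_L(s)},\qquad \kappa=\max\Bigl\{\frac{p}{1-p},\frac{1-p}{p}\Bigr\}.$$ **Statement.** Suppose $\gamma^{m-2}>\kappa$. Then there are sequences $(\Pi^n)$ of parsimonious protocols with $m$ states such that $\lim_n U^R(\Pi^n)=\sup_\Pi U^R(\Pi)$; along every such sequence $\lim_n U^S(\Pi^n)$ exists, and this limit, the sender's limiting payoff, is the same for all such sequences and depends only on $p$, $m$ and $\gamma$. For fixed $p$ it satisfies the following. (i) If $p<\frac12$, then, for each fixed $m\geq 3$, it is strictly increasing in $\gamma$ (on the range $\gamma^{m-2}>\kappa$) and tends to $p$ as $\gamma\to\infty$. (ii) If $p>\frac12$, then, for each fixed $m\geq 3$, it is strictly decreasing in $\gamma$ (on the range $\gamma^{m-2}>\kappa$); and it tends to $1$ as $\gamma^{m-2}\to\kappa$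 from above (also if $m$ varies along with $\gamma$). -/

import Mathlib

open Filter Topology

namespace StrategicLearning

/-- The two states of nature. -/
inductive Nature
  | H
  | L

/-- Conditionally i.i.d. signals from a finite set `S`: full-support signal distributions
`π_H`, `π_L` which are not identical. -/
structure SignalStructure (S : Type*) [Fintype S] where
  prob : Nature → S → ℝ
  prob_pos : ∀ θ s, 0 < prob θ s
  prob_sum : ∀ θ, ∑ s, prob θ s = 1
  prob_ne : prob Nature.H ≠ prob Nature.L

/-- The ratio of the maximum to the minimum likelihood ratio of the signals. -/
noncomputable def SignalStructure.gamma {S : Type*} [Fintype S] (E : SignalStructure S) : ℝ :=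
  (⨆ s, E.prob Nature.H s / E.prob Nature.L s) / (⨅ s, E.prob Nature.H s / E.prob Nature.L s)

/-- The skewness of the prior. -/
noncomputable def kappa (p : ℝ) : ℝ := max (p / (1 - p)) ((1 - p) / p)

/-- A protocol (finite automaton) with memory states `Fin m`: transition function `f`,
initial distribution `g`, and action rule `a` (probability of taking action `H`). -/
structure Protocol (S : Type*) (m : ℕ) where
  f : Fin m → S → Fin m → ℝ
  f_nonneg : ∀ i s j, 0 ≤ f i s j
  f_sum : ∀ i s, ∑ j, f i s j = 1
  g : Fin m → ℝ
  g_nonneg : ∀ i, 0 ≤ g i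
  g_sum : ∑ i, g i = 1
  a : Fin m → ℝ
  a_mem : ∀ i, a i ∈ Set.Icc (0 : ℝ) 1

/-- A sender strategy: the probability of stopping the signal process, given the current memory
state and the state of nature. -/
structure Strategy (m : ℕ) where
  halt : Fin m → Nature → ℝ
  halt_mem : ∀ i θ, halt i θ ∈ Set.Icc (0 : ℝ) 1

section

variable {S : Type*} [Fintype S] {m : ℕ}

/-- The memory state ceases to update in response to any signal. -/
def Protocol.Absorbing (P : Protocol S m) (i : Fin m) : Prop := ∀ s, P.f i s i = 1

/-- Transition matrix of the Markov chain on memory states that the protocol induces in state of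
nature `θ` (while signals keep being sent). -/
noncomputable def Protocol.trans (P : Protocol S m) (E : SignalStructure S) (θ : Nature) :
    Matrix (Fin m) (Fin m) ℝ :=
  Matrix.of fun i j => ∑ s, E.prob θ s * P.f i s j

/-- A memory state is transient if, starting from it, the expected number of visits to it is
finite in the induced Markov chain. -/
def Protocol.Transient (P : Protocol S m) (E : SignalStructure S) (i : Fin m) : Prop :=
  ∀ θ, Summable fun n : ℕ => ((P.trans E θ) ^ n) i i

/-- Parsimonious protocols: two absorbing memory states, one where `L` is played for sure and one
where `H` is played for sure; all other memory states are transient, with `L` played for sure. -/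
def Protocol.Parsimonious (P : Protocol S m) (E : SignalStructure S) : Prop :=
  ∃ iL iH : Fin m, P.Absorbing iL ∧ P.a iL = 0 ∧ P.Absorbing iH ∧ P.a iH = 1 ∧
    ∀ i, i ≠ iL → i ≠ iH → P.Transient E i ∧ P.a i = 0

open Classical in
/-- Probability that the game ends in a period that is entered in memory state `i`: it ends
automatically in an absorbing memory state, and otherwise when the sender stops. -/
noncomputable def endProb (P : Protocol S m) (σ : Strategy m) (θ : Nature) (i : Fin m) : ℝ :=
  if P.Absorbing i then 1 else σ.halt i θ

/-- `aliveProb P E σ θ t i` is the probability, given `θ`, that the game has not ended before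
period `t` and that the memory state at the beginning of period `t` is `i`. -/
noncomputable def aliveProb (P : Protocol S m) (E : SignalStructure S) (σ : Strategy m)
    (θ : Nature) : ℕ → Fin m → ℝ
  | 0 => P.g
  | t + 1 => fun j =>
      ∑ i, aliveProb P E σ θ t i * (1 - endProb P σ θ i) * P.trans E θ i j

/-- Probability, given `θ`, that the game ends in memory state `i` (in some period). -/
noncomputable def endsAt (P : Protocol S m) (E : SignalStructure S) (σ : Strategy m)
    (θ : Nature) (i : Fin m) : ℝ :=
  ∑' t : ℕ, aliveProb P E σ θ t i * endProb P σ θ i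

lemma endProb_mem {S : Type*} {m : ℕ} (P : Protocol S m) (σ : Strategy m) (θ : Nature) (i : Fin m) :
    endProb P σ θ i ∈ Set.Icc (0 : ℝ) 1 := by
  unfold endProb
  split_ifs
  · simp
  · exact σ.halt_mem i θ

lemma trans_nonneg (P : Protocol S m) (E : SignalStructure S) (θ : Nature) (i j : Fin m) :
    0 ≤ P.trans E θ i j :=
  Finset.sum_nonneg fun s _ => mul_nonneg (E.prob_pos θ s).le (P.f_nonneg i s j)

lemma trans_sum (P : Protocol S m) (E : SignalStructure S) (θ : Nature) (i : Fin m) :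
    ∑ j, P.trans E θ i j = 1 := by
  simp only [Protocol.trans, Matrix.of_apply]
  rw [Finset.sum_comm]
  simp [← Finset.mul_sum, P.f_sum, E.prob_sum]

lemma aliveProb_nonneg (P : Protocol S m) (E : SignalStructure S) (σ : Strategy m)
    (θ : Nature) (t : ℕ) (i : Fin m) : 0 ≤ aliveProb P E σ θ t i := by
  induction t generalizing i with
  | zero => exact P.g_nonneg i
  | succ t ih =>
    exact Finset.sum_nonneg fun j _ => mul_nonneg
      (mul_nonneg (ih j) (sub_nonneg.2 (endProb_mem P σ θ j).2)) (trans_nonneg P E θ j i)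

lemma aliveProb_sum_add (P : Protocol S m) (E : SignalStructure S) (σ : Strategy m)
    (θ : Nature) (t : ℕ) :
    ∑ i, aliveProb P E σ θ t i
      + ∑ u ∈ Finset.range t, ∑ i, aliveProb P E σ θ u i * endProb P σ θ i = 1 := by
  induction t with
  | zero => simpa [aliveProb] using P.g_sum
  | succ t ih =>
    have h : ∑ j, aliveProb P E σ θ (t + 1) j
        = ∑ i, aliveProb P E σ θ t i * (1 - endProb P σ θ i) := by
      simp only [aliveProb]
      rw [Finset.sum_comm]
      simp [← Finset.mul_sum, trans_sum]
    rw [Finset.sum_range_succ, h]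
    simp only [mul_sub, mul_one, Finset.sum_sub_distrib]
    linarith

/-- The series that defines `endsAt` converges. -/
lemma summable_endsAt (P : Protocol S m) (E : SignalStructure S) (σ : Strategy m)
    (θ : Nature) (i : Fin m) :
    Summable fun t : ℕ => aliveProb P E σ θ t i * endProb P σ θ i := by
  have hnn : ∀ t j, 0 ≤ aliveProb P E σ θ t j * endProb P σ θ j := fun t j =>
    mul_nonneg (aliveProb_nonneg P E σ θ t j) (endProb_mem P σ θ j).1
  refine summable_of_sum_range_le (c := 1) (fun t => hnn t i) fun n => ?_
  have h1 : ∑ t ∈ Finset.range n, aliveProb P E σ θ t i * endProb P σ θ i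
      ≤ ∑ t ∈ Finset.range n, ∑ j, aliveProb P E σ θ t j * endProb P σ θ j :=
    Finset.sum_le_sum fun t _ =>
      Finset.single_le_sum (f := fun j => aliveProb P E σ θ t j * endProb P σ θ j)
        (fun j _ => hnn t j) (Finset.mem_univ i)
  have h2 := aliveProb_sum_add P E σ θ n
  have h3 : 0 ≤ ∑ j, aliveProb P E σ θ n j :=
    Finset.sum_nonneg fun j _ => aliveProb_nonneg P E σ θ n j
  linarith

/-- Sender's expected payoff: 1 if action `H` is taken, 0 if `L` is taken or the game never
ends. -/
noncomputable def senderPayoff (p : ℝ) (E : SignalStructure S) (P : Protocol S m)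
    (σ : Strategy m) : ℝ :=
  p * ∑ i, endsAt P E σ Nature.H i * P.a i + (1 - p) * ∑ i, endsAt P E σ Nature.L i * P.a i

/-- Receiver's expected payoff: 1 if the action taken matches the state of nature, 0 if it does not
or the game never ends. -/
noncomputable def receiverPayoff (p : ℝ) (E : SignalStructure S) (P : Protocol S m)
    (σ : Strategy m) : ℝ :=
  p * ∑ i, endsAt P E σ Nature.H i * P.a i
    + (1 - p) * ∑ i, endsAt P E σ Nature.L i * (1 - P.a i)

/-- The sender's best responses to a protocol. -/
def bestResponses (p : ℝ) (E : SignalStructure S) (P : Protocol S m) : Set (Strategy m) :=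
  {σ | ∀ σ' : Strategy m, senderPayoff p E P σ' ≤ senderPayoff p E P σ}

/-- The receiver's optimal payoff: the supremum over all protocols with `m` memory states of his
payoff when the sender best responds. -/
noncomputable def receiverValue (p : ℝ) (E : SignalStructure S) (m : ℕ) : ℝ :=
  sSup {u : ℝ | ∃ P : Protocol S m, ∃ σ ∈ bestResponses p E P, u = receiverPayoff p E P σ}

/-- A sequence of parsimonious protocols, with sender best responses, that achieves the receiver's
optimal payoff in the limit. -/
def ReceiverOptimal (p : ℝ) (E : SignalStructure S) (P : ℕ → Protocol S m)
    (σ : ℕ → Strategy m) : Prop :=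
  (∀ n, (P n).Parsimonious E) ∧ (∀ n, σ n ∈ bestResponses p E (P n)) ∧
    Tendsto (fun n => receiverPayoff p E (P n) (σ n)) atTop (𝓝 (receiverValue p E m))

/-- `v` is the sender's limiting payoff: receiver-optimal sequences of parsimonious protocols
exist, and the sender's payoff converges to `v` along every one of them. -/
def IsSenderLimit (p : ℝ) (E : SignalStructure S) (m : ℕ) (v : ℝ) : Prop :=
  (∃ (P : ℕ → Protocol S m) (σ : ℕ → Strategy m), ReceiverOptimal p E P σ) ∧
    ∀ (P : ℕ → Protocol S m) (σ : ℕ → Strategy m), ReceiverOptimal p E P σ →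
      Tendsto (fun n => senderPayoff p E (P n) (σ n)) atTop (𝓝 v)

end

/-- The values of the informativeness `γ` for which `γ ^ (m - 2) > κ` (`m ≥ 2` memory states). -/
def gammaRange (p : ℝ) (m : ℕ) : Set ℝ := {x | 1 < x ∧ kappa p < x ^ (m - 2)}

end StrategicLearning

/-! Let `X` and `Y` be the probabilities of action H in the states of nature H and L, and `Γ = γ ^
(m - 2)`. Everything reduces to one inequality: under a best response, the odds of `X` are at most
`Γ` times the odds of `Y`.

For this bound, solve the sender's optimal stopping problem in state H and let `T` be the set where
stopping is optimal. In state L she could also stop exactly on `T`, so `Y` is at least the value of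
doing so. The two chains stopped on `T` differ only in their rows off `T`. Swapping one row
multiplies the odds of exiting at H by at most `γ` (`oddsLe_of_row`). Unless the reward is constant
on `T`, this set has two points, so at most `m - 2` swaps are needed (`oddsLe_pow`,
`oddsLe_of_bestResponse`).

Maximising `p X + (1 - p) (1 - Y)` under the bound is a one-variable problem in `D = Γ - (Γ - 1) X`,
where `Y ≥ X / D`. Its optimum `D = k`, `k ^ 2 = Γ (1 - p) / p`, is interior exactly when `Γ > κ`.
The loss controls both `(D - k) ^ 2` and `Y - X / D` (`receiver_loss`), so near-optimality for the
receiver forces `X` and `Y` to converge, and with them the sender's payoff, to `p + (2 p - 1) / (Γ -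
1)`.

The bound is attained in the limit by protocols that climb on the most H-favourable signal and reset
on the most L-favourable one, with climbs made ever rarer (`exists_climbing_protocol`). The claims
on `γ` are then read off the formula. -/

namespace StrategicLearning

/-! ### Harmonic functions of finite Markov chains -/

section Dirichlet

open Matrix

variable {ι : Type*}

/-- Every nonempty set of states disjoint from `T` can be left in one step: with positive
probability, `T` is reached from every state. -/
def Reaches (K : Matrix ι ι ℝ) (T : Set ι) : Prop :=
  ∀ C : Set ι, C.Nonempty → Disjoint C T → ∃ i ∈ C, ∃ j ∉ C, 0 < K i j

lemma Reaches.mono {K K' : Matrix ι ι ℝ} {T T' : Set ι} (h : Reaches K T) (hT : T ⊆ T')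
    (hK : ∀ i j, 0 < K i j → 0 < K' i j) : Reaches K' T' := by
  intro C hC hd
  obtain ⟨i, hi, j, hj, hij⟩ := h C hC (hd.mono_right hT)
  exact ⟨i, hi, j, hj, hK i j hij⟩

variable [Fintype ι]

/-- Row-stochastic matrices. -/
def Stochastic (K : Matrix ι ι ℝ) : Prop := (∀ i j, 0 ≤ K i j) ∧ ∀ i, ∑ j, K i j = 1

/-- `w` equals `r` on `T` and is harmonic off `T`. -/
def Harmonic (K : Matrix ι ι ℝ) (T : Set ι) (r w : ι → ℝ) : Prop :=
  (∀ i ∈ T, w i = r i) ∧ ∀ i ∉ T, w i = (K *ᵥ w) i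

lemma Stochastic.mulVec_mono {K : Matrix ι ι ℝ} (hK : Stochastic K) {u v : ι → ℝ}
    (h : ∀ i, u i ≤ v i) (i : ι) : (K *ᵥ u) i ≤ (K *ᵥ v) i :=
  Finset.sum_le_sum fun j _ => mul_le_mul_of_nonneg_left (h j) (hK.1 i j)

lemma Stochastic.mulVec_const {K : Matrix ι ι ℝ} (hK : Stochastic K) (c : ℝ) (i : ι) :
    (K *ᵥ fun _ => c) i = c := by
  simp [mulVec, dotProduct, ← Finset.sum_mul, hK.2 i]

/-- Maximum principle. -/
lemma Stochastic.nonpos_of_subharmonic {K : Matrix ι ι ℝ} (hK : Stochastic K) {T : Set ι}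
    (hT : Reaches K T) {u : ι → ℝ} (hu : ∀ i ∉ T, u i ≤ (K *ᵥ u) i) (hb : ∀ i ∈ T, u i ≤ 0)
    (i : ι) : u i ≤ 0 := by
  have : Nonempty ι := ⟨i⟩
  obtain ⟨k, hk⟩ := Finite.exists_max u
  by_contra! hi
  have hkpos : 0 < u k := hi.trans_le (hk i)
  -- A positive maximum is attained off `T` only. At a state from which the set of maximisers can be
  -- left, the average of `u` lies strictly below the maximum.
  obtain ⟨a, ha, b, hb', hab⟩ := hT {j | u j = u k} ⟨k, rfl⟩ (by
    rw [Set.disjoint_left]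
    intro j hj hjT
    have h1 := hb j hjT
    have h2 : u j = u k := hj
    linarith)
  have haT : a ∉ T := fun h => by
    have h1 := hb a h
    have h2 : u a = u k := ha
    linarith
  have h1 := hu a haT
  have h2 : (K *ᵥ u) a < ∑ j, K a j * u k := by
    refine Finset.sum_lt_sum (fun j _ => mul_le_mul_of_nonneg_left (hk j) (hK.1 a j))
      ⟨b, Finset.mem_univ _, ?_⟩
    exact mul_lt_mul_of_pos_left (lt_of_le_of_ne (hk b) hb') hab
  rw [← Finset.sum_mul, hK.2, one_mul] at h2
  have h3 : u a = u k := ha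
  linarith

lemma Stochastic.le_of_subharmonic {K : Matrix ι ι ℝ} (hK : Stochastic K) {T : Set ι}
    (hT : Reaches K T) {u v : ι → ℝ} (hu : ∀ i ∉ T, u i ≤ (K *ᵥ u) i)
    (hv : ∀ i ∉ T, (K *ᵥ v) i ≤ v i) (hb : ∀ i ∈ T, u i ≤ v i) (i : ι) : u i ≤ v i := by
  have := hK.nonpos_of_subharmonic hT (u := u - v)
    (fun i hi => by
      have h1 := hu i hi
      have h2 := hv i hi
      simp only [mulVec_sub, Pi.sub_apply]
      linarith)
    (fun i hi => by simpa using hb i hi) i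
  simpa using this

lemma Harmonic.eq {K : Matrix ι ι ℝ} (hK : Stochastic K) {T : Set ι} (hT : Reaches K T)
    {r w w' : ι → ℝ} (h : Harmonic K T r w) (h' : Harmonic K T r w') : w = w' := by
  funext i
  apply le_antisymm
  · exact hK.le_of_subharmonic hT (fun i hi => (h.2 i hi).le) (fun i hi => (h'.2 i hi).ge)
      (fun i hi => by rw [h.1 i hi, h'.1 i hi]) i
  · exact hK.le_of_subharmonic hT (fun i hi => (h'.2 i hi).le) (fun i hi => (h.2 i hi).ge)
      (fun i hi => by rw [h.1 i hi, h'.1 i hi]) i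

lemma Harmonic.nonneg {K : Matrix ι ι ℝ} (hK : Stochastic K) {T : Set ι} (hT : Reaches K T)
    {r w : ι → ℝ} (h : Harmonic K T r w) (hr : ∀ i ∈ T, 0 ≤ r i) (i : ι) : 0 ≤ w i :=
  hK.le_of_subharmonic hT (u := fun _ => 0) (fun i _ => (hK.mulVec_const 0 i).ge)
    (fun i hi => (h.2 i hi).ge) (fun i hi => by rw [h.1 i hi]; exact hr i hi) i

lemma Harmonic.le_one {K : Matrix ι ι ℝ} (hK : Stochastic K) {T : Set ι} (hT : Reaches K T)
    {r w : ι → ℝ} (h : Harmonic K T r w) (hr : ∀ i ∈ T, r i ≤ 1) (i : ι) : w i ≤ 1 :=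
  hK.le_of_subharmonic hT (v := fun _ => 1) (fun i hi => (h.2 i hi).le)
    (fun i _ => (hK.mulVec_const 1 i).le) (fun i hi => by rw [h.1 i hi]; exact hr i hi) i

/-- The Poisson problem with boundary values on a set that is reached from everywhere has a
solution. -/
lemma Stochastic.exists_poisson {K : Matrix ι ι ℝ} (hK : Stochastic K) {T : Set ι}
    (hT : Reaches K T) (r c : ι → ℝ) :
    ∃ w : ι → ℝ, (∀ i ∈ T, w i = r i) ∧ ∀ i ∉ T, w i = c i + (K *ᵥ w) i := by
  classical
  -- Finite dimension turns uniqueness, i.e. injectivity of this operator, into existence.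
  let A : (ι → ℝ) →ₗ[ℝ] (ι → ℝ) :=
    { toFun := fun w i => if i ∈ T then w i else w i - (K *ᵥ w) i
      map_add' := fun u v => by
        funext i
        by_cases hi : i ∈ T <;> simp [hi, mulVec_add]
        ring
      map_smul' := fun b u => by
        funext i
        by_cases hi : i ∈ T <;> simp [hi, mulVec_smul]
        ring }
  have hA : ∀ w i, A w i = if i ∈ T then w i else w i - (K *ᵥ w) i := fun _ _ => rfl
  have hinj : Function.Injective A := by
    rw [← LinearMap.ker_eq_bot, LinearMap.ker_eq_bot']
    intro w hw
    have h0 : Harmonic K T 0 w := by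
      refine ⟨fun i hi => ?_, fun i hi => ?_⟩
      · simpa [hA, hi] using congrFun hw i
      · have := congrFun hw i
        rw [hA, if_neg hi] at this
        simpa [sub_eq_zero] using this
    exact h0.eq hK hT ⟨fun _ _ => rfl, fun i _ => by simp⟩
  obtain ⟨w, hw⟩ := LinearMap.injective_iff_surjective.1 hinj
    (fun i => if i ∈ T then r i else c i)
  refine ⟨w, fun i hi => ?_, fun i hi => ?_⟩
  · simpa [hA, hi] using congrFun hw i
  · have := congrFun hw i
    rw [hA, if_neg hi] at this
    simp only [hi, if_false] at this
    linarith

lemma Stochastic.exists_harmonic {K : Matrix ι ι ℝ} (hK : Stochastic K) {T : Set ι}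
    (hT : Reaches K T) (r : ι → ℝ) : ∃ w, Harmonic K T r w := by
  obtain ⟨w, h1, h2⟩ := hK.exists_poisson hT r 0
  exact ⟨w, h1, fun i hi => by simpa using h2 i hi⟩

/-- Expected number of steps before `T` is hit. -/
lemma Stochastic.exists_hitting_time {K : Matrix ι ι ℝ} (hK : Stochastic K) {T : Set ι}
    (hT : Reaches K T) :
    ∃ τ : ι → ℝ, (∀ i, 0 ≤ τ i) ∧ (∀ i ∈ T, τ i = 0) ∧ ∀ i ∉ T, τ i = 1 + (K *ᵥ τ) i := by
  obtain ⟨τ, h1, h2⟩ := hK.exists_poisson hT 0 1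
  refine ⟨τ, fun i => ?_, h1, fun i hi => by simpa using h2 i hi⟩
  refine hK.le_of_subharmonic hT (u := fun _ => 0) (fun i _ => (hK.mulVec_const 0 i).ge)
    (fun i hi => ?_) (fun i hi => (h1 i hi).ge) i
  have := h2 i hi
  simp only [Pi.one_apply] at this
  linarith

/-! ### Comparing exit odds of two chains -/

/-- The odds of `X` are at most `c` times the odds of `Y`. -/
def OddsLe (c X Y : ℝ) : Prop := X * (1 - Y) ≤ c * (Y * (1 - X))

/-- Multiply the two inequalities and cancel `Y * (1 - Y)`. The cross-multiplied form of the odds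
admits the degenerate cases: `Y = 0` forces `X = 0`, and `Y = 1` forces `Z = 1`. -/
lemma OddsLe.trans {c d X Y Z : ℝ} (hc : 0 ≤ c) (hd : 0 ≤ d) (hX0 : 0 ≤ X) (hX1 : X ≤ 1)
    (hY0 : 0 ≤ Y) (hY1 : Y ≤ 1) (hZ0 : 0 ≤ Z) (hZ1 : Z ≤ 1) (h : OddsLe c X Y)
    (h' : OddsLe d Y Z) : OddsLe (c * d) X Z := by
  unfold OddsLe at *
  rcases hY0.eq_or_lt with rfl | hY0
  · have : X = 0 := by linarith
    subst this
    simpa using mul_nonneg (mul_nonneg hc hd) hZ0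
  rcases hY1.eq_or_lt with rfl | hY1
  · have : Z = 1 := by linarith
    subst this
    simpa using mul_nonneg (mul_nonneg hc hd) (sub_nonneg.2 hX1)
  have hp : 0 < Y * (1 - Y) := mul_pos hY0 (by linarith)
  refine le_of_mul_le_mul_left ?_ hp
  have h1 : 0 ≤ X * (1 - Y) := mul_nonneg hX0 (by linarith)
  have h2 : 0 ≤ Y * (1 - Z) := mul_nonneg hY0.le (by linarith)
  have h3 := mul_le_mul h h' h2 (h1.trans h)
  nlinarith

/-- Replacing the transition probabilities out of one state, by others whose likelihood ratios lie
in `[lo, hi]`, changes the odds of exit by a factor of at most `hi / lo`. -/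
lemma oddsLe_of_row {K K' : Matrix ι ι ℝ} (hK : Stochastic K) (hK' : Stochastic K') {T : Set ι}
    (hT : Reaches K T) (hT' : Reaches K' T) {v : ι} (hv : v ∉ T) (hrow : ∀ i ≠ v, K' i = K i)
    {lo hi : ℝ} (hlo : 0 < lo) (hlohi : lo ≤ hi) (hl : ∀ j, lo * K' v j ≤ K v j)
    (hh : ∀ j, K v j ≤ hi * K' v j)
    {r w w' : ι → ℝ} (hr0 : ∀ i, 0 ≤ r i) (hr1 : ∀ i, r i ≤ 1)
    (hw : Harmonic K T r w) (hw' : Harmonic K' T r w')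
    {g : ι → ℝ} (hg0 : ∀ i, 0 ≤ g i) (hg1 : ∑ i, g i = 1) :
    OddsLe (hi / lo) (g ⬝ᵥ w) (g ⬝ᵥ w') := by
  classical
  have hTv : Reaches K (insert v T) := hT.mono (Set.subset_insert v T) fun _ _ => id
  have hnT : ∀ {i}, i ∉ insert v T → i ≠ v ∧ i ∉ T := fun {i} h => by
    simpa [not_or] using h
  have hmulVec : ∀ (u : ι → ℝ) (i), i ≠ v → (K' *ᵥ u) i = (K *ᵥ u) i := fun u i hi => by
    simp only [mulVec, hrow i hi]
  -- Cut the chain at `v`: `α`, `β`, `δ` describe exiting with reward `r`, exiting with reward `1 -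
  -- r`, and reaching `v`, all upon the first visit to `insert v T`. They do not involve row `v`, so
  -- they serve both chains.
  obtain ⟨α, hα⟩ := hK.exists_harmonic hTv (fun i => if i = v then 0 else r i)
  obtain ⟨β, hβ⟩ := hK.exists_harmonic hTv (fun i => if i = v then 0 else 1 - r i)
  obtain ⟨δ, hδ⟩ := hK.exists_harmonic hTv (fun i => if i = v then 1 else 0)
  have hαn := hα.nonneg hK hTv (fun i _ => by by_cases h : i = v <;> simp [h, hr0])
  have hβn := hβ.nonneg hK hTv (fun i _ => by by_cases h : i = v <;> simp [h, hr1])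
  have hδn := hδ.nonneg hK hTv (fun i _ => by by_cases h : i = v <;> simp [h])
  have hαv : α v = 0 := by simpa using hα.1 v (Set.mem_insert v T)
  have hβv : β v = 0 := by simpa using hβ.1 v (Set.mem_insert v T)
  have hδv : δ v = 1 := by simpa using hδ.1 v (Set.mem_insert v T)
  have hne : ∀ {i}, i ∈ T → i ≠ v := fun h h' => hv (h' ▸ h)
  have hsum : α + β + δ = fun _ => 1 := by
    refine Harmonic.eq hK hTv (r := fun _ => 1) ⟨fun i hi => ?_, fun i hi => ?_⟩
      ⟨fun _ _ => rfl, fun i _ => (hK.mulVec_const 1 i).symm⟩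
    · simp only [Pi.add_apply, hα.1 i hi, hβ.1 i hi, hδ.1 i hi]
      by_cases h : i = v <;> simp [h]
    · simp only [mulVec_add, Pi.add_apply, ← hα.2 i hi, ← hβ.2 i hi, ← hδ.2 i hi]
  have hdec : ∀ u : ι → ℝ, (∀ i ∈ T, u i = r i) → (∀ i ∉ insert v T, u i = (K *ᵥ u) i) →
      u = α + u v • δ := by
    intro u hu1 hu2
    refine Harmonic.eq hK hTv (r := u) ⟨fun i _ => rfl, hu2⟩ ⟨fun i hi => ?_, fun i hi => ?_⟩
    · simp only [Pi.add_apply, Pi.smul_apply, smul_eq_mul, hα.1 i hi, hδ.1 i hi]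
      by_cases h : i = v
      · simp [h]
      · have : i ∈ T := (Set.mem_insert_iff.1 hi).resolve_left h
        simp [h, hu1 i this]
    · simp only [mulVec_add, mulVec_smul, Pi.add_apply, Pi.smul_apply, ← hα.2 i hi,
        ← hδ.2 i hi]
  have hwd := hdec w hw.1 fun i hi => hw.2 i (hnT hi).2
  have hwd' := hdec w' hw'.1 fun i hi => by
    rw [← hmulVec w' i (hnT hi).1]; exact hw'.2 i (hnT hi).2
  have hnn : ∀ {M : Matrix ι ι ℝ}, Stochastic M → ∀ {u : ι → ℝ}, (∀ i, 0 ≤ u i) →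
      0 ≤ (M *ᵥ u) v := fun hM u hu =>
    Finset.sum_nonneg fun j _ => mul_nonneg (hM.1 v j) (hu j)
  -- Renewal at `v`: excursions that return to `v` are discarded, so the odds at `v` are `(M *ᵥ α)
  -- v` to `(M *ᵥ β) v`, which are linear in row `v`.
  have key : ∀ {M : Matrix ι ι ℝ}, Stochastic M → Reaches M T → (∀ i ≠ v, M i = K i) →
      ∀ {u : ι → ℝ}, u = α + u v • δ → u v = (M *ᵥ u) v →
        u v * ((M *ᵥ α) v + (M *ᵥ β) v) = (M *ᵥ α) v ∧ 0 < (M *ᵥ α) v + (M *ᵥ β) v := by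
    intro M hM hMT hMrow u hu huv
    have h1 : (M *ᵥ α) v + (M *ᵥ β) v + (M *ᵥ δ) v = 1 := by
      have := hM.mulVec_const 1 v
      rw [← hsum, mulVec_add, mulVec_add] at this
      simpa using this
    have h2 : u v = (M *ᵥ α) v + u v * (M *ᵥ δ) v := by
      conv_lhs => rw [huv, hu]
      simp [mulVec_add, mulVec_smul]
    refine ⟨by linear_combination h2 + u v * h1, ?_⟩
    -- If an excursion from `v` never ended in `T`, then `δ` would be harmonic for `M` with boundary
    -- value 0, hence zero, against `δ v = 1`.
    refine lt_of_le_of_ne (add_nonneg (hnn hM hαn) (hnn hM hβn)) fun h0 => ?_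
    have hδ0 : δ = 0 := by
      refine Harmonic.eq hM hMT (r := 0) ⟨fun i hi => ?_, fun i hi => ?_⟩
        ⟨fun _ _ => rfl, fun i _ => by simp⟩
      · simpa [hne hi] using hδ.1 i (Set.mem_insert_of_mem v hi)
      · by_cases h : i = v
        · subst h
          rw [hδv]; linarith
        · rw [hδ.2 i (by simp [h, hi])]
          simp only [mulVec, hMrow i h]
    rw [hδ0] at hδv
    simp at hδv
  obtain ⟨e1, p1⟩ := key hK hT (fun _ _ => rfl) hwd (hw.2 v hv)
  obtain ⟨e2, p2⟩ := key hK' hT' hrow hwd' (hw'.2 v hv)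
  have hh' : (K *ᵥ α) v ≤ hi * (K' *ᵥ α) v := by
    simp only [mulVec, dotProduct, Finset.mul_sum, ← mul_assoc]
    exact Finset.sum_le_sum fun j _ => mul_le_mul_of_nonneg_right (hh j) (hαn j)
  have hl' : lo * (K' *ᵥ β) v ≤ (K *ᵥ β) v := by
    simp only [mulVec, dotProduct, Finset.mul_sum, ← mul_assoc]
    exact Finset.sum_le_sum fun j _ => mul_le_mul_of_nonneg_right (hl j) (hβn j)
  have hα1 := hnn hK hαn
  have hα2 := hnn hK' hαn
  have hβ1 := hnn hK hβn
  have hβ2 := hnn hK' hβn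
  set x := w v
  set x' := w' v
  have hx0 : 0 ≤ x := hw.nonneg hK hT (fun i _ => hr0 i) v
  have hx1 : x ≤ 1 := hw.le_one hK hT (fun i _ => hr1 i) v
  have hx0' : 0 ≤ x' := hw'.nonneg hK' hT' (fun i _ => hr0 i) v
  have hx1' : x' ≤ 1 := hw'.le_one hK' hT' (fun i _ => hr1 i) v
  have hγ : 1 ≤ hi / lo := (one_le_div hlo).2 hlohi
  have hxx : OddsLe (hi / lo) x x' := by
    unfold OddsLe
    rw [div_mul_eq_mul_div, le_div_iff₀ hlo]
    refine le_of_mul_le_mul_right ?_ (mul_pos p1 p2)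
    have e1' : (1 - x) * ((K *ᵥ α) v + (K *ᵥ β) v) = (K *ᵥ β) v := by linear_combination -e1
    have e2' : (1 - x') * ((K' *ᵥ α) v + (K' *ᵥ β) v) = (K' *ᵥ β) v := by
      linear_combination -e2
    calc x * (1 - x') * lo * (((K *ᵥ α) v + (K *ᵥ β) v) * ((K' *ᵥ α) v + (K' *ᵥ β) v))
        = (x * ((K *ᵥ α) v + (K *ᵥ β) v)) *
            (lo * ((1 - x') * ((K' *ᵥ α) v + (K' *ᵥ β) v))) := by ring
      _ ≤ (hi * (K' *ᵥ α) v) * (K *ᵥ β) v := by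
          rw [e1, e2']
          exact mul_le_mul hh' hl' (mul_nonneg hlo.le hβ2)
            (mul_nonneg (hlo.le.trans hlohi) hα2)
      _ = _ := by
          conv_lhs => rw [← e1', ← e2]
          ring
  have hgd : ∀ {u : ι → ℝ}, (∀ i, 0 ≤ u i) → 0 ≤ g ⬝ᵥ u := fun hu =>
    Finset.sum_nonneg fun j _ => mul_nonneg (hg0 j) (hu j)
  have hg : g ⬝ᵥ α + g ⬝ᵥ β + g ⬝ᵥ δ = 1 := by
    rw [← dotProduct_add, ← dotProduct_add, hsum]
    simpa [dotProduct] using hg1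
  have ew : g ⬝ᵥ w = g ⬝ᵥ α + x * g ⬝ᵥ δ := by
    conv_lhs => rw [hwd]
    simp [dotProduct_add, dotProduct_smul]
  have ew' : g ⬝ᵥ w' = g ⬝ᵥ α + x' * g ⬝ᵥ δ := by
    conv_lhs => rw [hwd']
    simp [dotProduct_add, dotProduct_smul]
  have hA := hgd hαn
  have hB := hgd hβn
  have hD := hgd hδn
  rw [ew, ew']
  generalize g ⬝ᵥ α = A at *
  generalize g ⬝ᵥ β = B at *
  generalize g ⬝ᵥ δ = D at *
  generalize hi / lo = c at *
  have f1 : x ≤ c * x' := by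
    rcases le_total x x' with h | h
    · nlinarith
    · unfold OddsLe at hxx
      rcases hx1'.eq_or_lt with h1 | h1
      · nlinarith
      · refine le_of_mul_le_mul_right (hxx.trans ?_) (by linarith : 0 < 1 - x')
        have := mul_nonneg (mul_nonneg (by linarith : 0 ≤ c) hx0') (by linarith : 0 ≤ x - x')
        nlinarith
  have f2 : 1 - x' ≤ c * (1 - x) := by
    rcases le_total x x' with h | h
    · nlinarith
    · unfold OddsLe at hxx
      rcases hx0.eq_or_lt with h1 | h1
      · nlinarith
      · refine le_of_mul_le_mul_left (hxx.trans ?_) h1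
        have := mul_nonneg (mul_nonneg (by linarith : 0 ≤ c) (by linarith : 0 ≤ 1 - x))
          (by linarith : 0 ≤ x - x')
        nlinarith
  unfold OddsLe at hxx ⊢
  have g1 : 1 - (A + x' * D) = B + (1 - x') * D := by linear_combination -hg
  have g2 : 1 - (A + x * D) = B + (1 - x) * D := by linear_combination -hg
  rw [g1, g2]
  have k1 := mul_nonneg (mul_nonneg hA hB) (by linarith : 0 ≤ c - 1)
  have k2 := mul_nonneg (mul_nonneg hA hD) (sub_nonneg.2 f2)
  have k3 := mul_nonneg (mul_nonneg hB hD) (sub_nonneg.2 f1)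
  have k4 := mul_nonneg (mul_nonneg hD hD) (sub_nonneg.2 hxx)
  nlinarith

lemma dotProduct_mem_Icc {g w : ι → ℝ} (hg0 : ∀ i, 0 ≤ g i) (hg1 : ∑ i, g i = 1)
    (h0 : ∀ i, 0 ≤ w i) (h1 : ∀ i, w i ≤ 1) : g ⬝ᵥ w ∈ Set.Icc (0 : ℝ) 1 := by
  refine ⟨Finset.sum_nonneg fun i _ => mul_nonneg (hg0 i) (h0 i), ?_⟩
  rw [← hg1]
  exact Finset.sum_le_sum fun i _ => mul_le_of_le_one_right (hg0 i) (h1 i)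

/-- Odds of exit of two chains whose likelihood ratios lie in `[lo, hi]`, when there are `k` states
off the exit set. -/
lemma oddsLe_pow {K K' : Matrix ι ι ℝ} (hK : Stochastic K) (hK' : Stochastic K') {T : Set ι}
    (hT : Reaches K T) {lo hi : ℝ} (hlo : 0 < lo) (hlohi : lo ≤ hi)
    (hl : ∀ i j, lo * K' i j ≤ K i j) (hh : ∀ i j, K i j ≤ hi * K' i j)
    {r w w' : ι → ℝ} (hr0 : ∀ i, 0 ≤ r i) (hr1 : ∀ i, r i ≤ 1)
    (hw : Harmonic K T r w) (hw' : Harmonic K' T r w')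
    {g : ι → ℝ} (hg0 : ∀ i, 0 ≤ g i) (hg1 : ∑ i, g i = 1) :
    OddsLe ((hi / lo) ^ (Tᶜ).ncard) (g ⬝ᵥ w) (g ⬝ᵥ w') := by
  classical
  have hhi : 0 < hi := hlo.trans_le hlohi
  -- Hybrid chains: rows in `A` come from `K'`, the others from `K`. Enlarging `A` by one state is a
  -- single row swap.
  let M : Finset ι → Matrix ι ι ℝ := fun A => Matrix.of fun i => if i ∈ A then K' i else K i
  have hMs : ∀ A, Stochastic (M A) := fun A => by
    refine ⟨fun i j => ?_, fun i => ?_⟩ <;> by_cases h : i ∈ A <;>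
      simp [M, h, hK.1, hK'.1, hK.2, hK'.2]
  have hMT : ∀ A, Reaches (M A) T := fun A => by
    refine hT.mono subset_rfl fun i j hij => ?_
    have : 0 < K' i j := by
      have := hh i j
      by_contra! h
      nlinarith
    by_cases h : i ∈ A <;> simp [M, h, hij, this]
  have step : ∀ A : Finset ι, (∀ i ∈ A, i ∉ T) → ∀ u, Harmonic (M A) T r u →
      OddsLe ((hi / lo) ^ A.card) (g ⬝ᵥ w) (g ⬝ᵥ u) := by
    intro A
    induction A using Finset.induction_on with
    | empty =>
      intro _ u hu
      have hM0 : M ∅ = K := by ext i j; simp [M]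
      rw [hM0] at hu
      rw [hw.eq hK hT hu]
      simp [OddsLe]
    | insert v A hvA ih =>
      intro hA u hu
      obtain ⟨u', hu'⟩ := (hMs A).exists_harmonic (hMT A) r
      have h1 := ih (fun i hi => hA i (Finset.mem_insert_of_mem hi)) u' hu'
      have h2 : OddsLe (hi / lo) (g ⬝ᵥ u') (g ⬝ᵥ u) := by
        refine oddsLe_of_row (hMs A) (hMs _) (hMT A) (hMT _)
          (hA v (Finset.mem_insert_self v A)) (fun i hi => ?_) hlo hlohi (fun j => ?_)
          (fun j => ?_) hr0 hr1 hu' hu hg0 hg1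
        · ext j; simp [M, hi]
        · simpa [M, hvA] using hl v j
        · simpa [M, hvA] using hh v j
      rw [Finset.card_insert_of_notMem hvA, pow_succ]
      have b : ∀ {M : Matrix ι ι ℝ}, Stochastic M → Reaches M T → ∀ {u}, Harmonic M T r u →
          g ⬝ᵥ u ∈ Set.Icc (0 : ℝ) 1 := fun hM hMT u hu =>
        dotProduct_mem_Icc hg0 hg1 (hu.nonneg hM hMT fun i _ => hr0 i)
          (hu.le_one hM hMT fun i _ => hr1 i)
      have b1 := b hK hT hw
      have b2 := b (hMs A) (hMT A) hu'
      have b3 := b (hMs _) (hMT _) hu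
      exact h1.trans (pow_nonneg (div_pos hhi hlo).le _) (div_pos hhi hlo).le b1.1 b1.2 b2.1 b2.2 b3.1 b3.2 h2
  -- Rows in `T` need not be swapped, since harmonicity is only required off `T`.
  have hfin := step (Finset.univ.filter (· ∉ T)) (by simp) w' (by
    refine ⟨hw'.1, fun i hi => ?_⟩
    rw [hw'.2 i hi]
    simp [mulVec, M, hi])
  rwa [Set.ncard_eq_toFinset_card', show (Tᶜ).toFinset = Finset.univ.filter (· ∉ T) by
    ext; simp]

/-! ### Optimal stopping -/

/-- Optimal stopping of a finite chain: a superharmonic majorant of the stopping reward which is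
harmonic off its contact set, and the contact set is reached from every state. -/
lemma Stochastic.exists_value {K : Matrix ι ι ℝ} (hK : Stochastic K) {a : ι → ℝ}
    (ha1 : ∀ i, a i ≤ 1) :
    ∃ v : ι → ℝ, (∀ i, a i ≤ v i) ∧ (∀ i, (K *ᵥ v) i ≤ v i) ∧ Reaches K {i | v i = a i} ∧
      Harmonic K {i | v i = a i} a v := by
  classical
  -- The value is a minimiser of the coordinate sum over the compact set of superharmonic majorants
  -- bounded by 1. Both remaining claims follow by lowering `v` within this set.
  let A : Set (ι → ℝ) := {v | (∀ i, v i ∈ Set.Icc (a i) 1) ∧ ∀ i, (K *ᵥ v) i ≤ v i}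
  have hAc : IsCompact A := by
    have h1 : A = Set.Icc a 1 ∩ {v | ∀ i, (K *ᵥ v) i ≤ v i} := by
      ext v
      simp only [A, Set.mem_ofPred_eq, Set.mem_inter_iff, Set.mem_Icc, Pi.le_def, forall_and,
        Pi.one_apply]
    rw [h1]
    refine isCompact_Icc.inter_right ?_
    rw [Set.ofPred_forall]
    refine isClosed_iInter fun i => isClosed_le ?_ (continuous_apply i)
    simp only [mulVec, dotProduct]
    fun_prop
  have hAn : A.Nonempty :=
    ⟨fun _ => 1, fun i => ⟨ha1 i, le_rfl⟩, fun i => (hK.mulVec_const 1 i).le⟩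
  obtain ⟨v, hv, hmin⟩ := hAc.exists_isMinOn hAn
    (f := fun v : ι → ℝ => ∑ i, v i) (by fun_prop)
  have least : ∀ u ∈ A, (∀ i, u i ≤ v i) → ∀ i, u i = v i := by
    intro u hu huv
    have h1 : ∑ i, v i ≤ ∑ i, u i := hmin hu
    have h2 := (Finset.sum_eq_sum_iff_of_le fun i (_ : i ∈ Finset.univ) => huv i).1
      (le_antisymm (Finset.sum_le_sum fun i _ => huv i) h1)
    exact fun i => h2 i (Finset.mem_univ i)
  refine ⟨v, fun i => (hv.1 i).1, hv.2, ?_, fun i hi => hi, fun i hi => ?_⟩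
  -- If `C` could not be left, capping `v` on `C` at the maximum of `a` over `C` would keep it a
  -- superharmonic majorant. Minimality then makes `v` equal `a` at the maximiser, a contact point
  -- in `C`.
  · intro C hC hCT
    by_contra! hcl
    obtain ⟨k, hkC, hk⟩ := C.toFinite.exists_maximalFor a C hC
    have hmax : ∀ i ∈ C, a i ≤ a k := fun i hi => by
      rcases le_total (a i) (a k) with h | h
      · exact h
      · exact hk hi h
    let u : ι → ℝ := fun i => if i ∈ C then min (v i) (a k) else v i
    have huv : ∀ i, u i ≤ v i := fun i => by
      by_cases h : i ∈ C <;> simp [u, h]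
    have hu : u ∈ A := by
      refine ⟨fun i => ⟨?_, (huv i).trans (hv.1 i).2⟩, fun i => ?_⟩
      · by_cases h : i ∈ C <;> simp [u, h, (hv.1 i).1, hmax]
      · have h1 : (K *ᵥ u) i ≤ v i := (hK.mulVec_mono huv i).trans (hv.2 i)
        by_cases h : i ∈ C
        · simp only [u, h, if_true]
          refine le_min h1 ?_
          calc (K *ᵥ u) i ≤ ∑ j, K i j * a k := by
                refine Finset.sum_le_sum fun j _ => ?_
                by_cases hj : j ∈ C
                · refine mul_le_mul_of_nonneg_left ?_ (hK.1 i j)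
                  simp [u, hj]
                · have : K i j = 0 := le_antisymm (hcl i h j hj) (hK.1 i j)
                  simp [this]
            _ = a k := by rw [← Finset.sum_mul, hK.2, one_mul]
        · simpa [u, h] using h1
    have h1 := least u hu huv k
    simp only [u, hkC, if_true] at h1
    have h2 : v k = a k :=
      le_antisymm (by rw [← h1]; exact min_le_right _ _) (hv.1 k).1
    exact Set.disjoint_left.1 hCT hkC h2
  · refine le_antisymm ?_ (hv.2 i)
    -- Lowering `v` at `i` to the larger of stopping and continuing stays in `A`, so `v i` already
    -- is that maximum; off the contact set it must be the continuation value.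
    let u : ι → ℝ := Function.update v i (max (a i) ((K *ᵥ v) i))
    have huv : ∀ j, u j ≤ v j := fun j => by
      by_cases h : j = i
      · subst h; simp [u, (hv.1 j).1, hv.2 j]
      · simp [u, h]
    have hu : u ∈ A := by
      refine ⟨fun j => ⟨?_, (huv j).trans (hv.1 j).2⟩, fun j => ?_⟩
      · by_cases h : j = i
        · subst h; simp [u]
        · simp [u, h, (hv.1 j).1]
      · have h1 := hK.mulVec_mono huv j
        by_cases h : j = i
        · subst h
          simp only [u, Function.update_self]
          exact h1.trans (le_max_right _ _)
        · simp only [u, Function.update_of_ne h]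
          exact h1.trans (hv.2 j)
    have h1 := least u hu huv i
    simp only [u, Function.update_self] at h1
    rcases max_choice (a i) ((K *ᵥ v) i) with h2 | h2
    · exact absurd (h1.symm.trans h2) hi
    · rw [← h1, h2]

end Dirichlet

/-! ### Action probabilities under best responses -/

section Game

open Matrix

variable {S : Type*} {m : ℕ}

lemma endProb_congr {P : Protocol S m} {σ σ' : Strategy m} {θ : Nature}
    (h : ∀ i, σ.halt i θ = σ'.halt i θ) : endProb P σ θ = endProb P σ' θ := by
  funext i
  simp only [endProb, h]

variable [Fintype S]

lemma Protocol.trans_stochastic (P : Protocol S m) (E : SignalStructure S) (θ : Nature) :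
    Stochastic (P.trans E θ) :=
  ⟨trans_nonneg P E θ, trans_sum P E θ⟩

lemma Protocol.Absorbing.trans_eq_zero {P : Protocol S m} {i : Fin m} (h : P.Absorbing i)
    (E : SignalStructure S) (θ : Nature) {j : Fin m} (hj : j ≠ i) : P.trans E θ i j = 0 := by
  have h1 : P.trans E θ i i = 1 := by simp [Protocol.trans, h _, E.prob_sum]
  have h2 := trans_sum P E θ i
  rw [← Finset.add_sum_erase _ _ (Finset.mem_univ i), h1] at h2
  have h3 : ∑ k ∈ Finset.univ.erase i, P.trans E θ i k = 0 := by linarith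
  exact (Finset.sum_eq_zero_iff_of_nonneg fun k _ => trans_nonneg P E θ i k).1 h3 j
    (Finset.mem_erase.2 ⟨hj, Finset.mem_univ j⟩)

lemma Protocol.Absorbing.mem_of_reaches {P : Protocol S m} {i : Fin m} (h : P.Absorbing i)
    {E : SignalStructure S} {θ : Nature} {T : Set (Fin m)} (hT : Reaches (P.trans E θ) T) :
    i ∈ T := by
  by_contra hi
  obtain ⟨k, hk, j, hj, hkj⟩ := hT {i} ⟨i, rfl⟩ (by simpa using hi)
  obtain rfl : k = i := hk
  rw [h.trans_eq_zero E θ hj] at hkj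
  exact lt_irrefl _ hkj

/-- Probability that action `H` is taken. -/
noncomputable def probH (P : Protocol S m) (E : SignalStructure S) (σ : Strategy m)
    (θ : Nature) : ℝ :=
  ∑ i, endsAt P E σ θ i * P.a i

/-- The sender's problem separates across states of nature, so her play in L can be altered without
affecting H. -/
lemma endsAt_congr {P : Protocol S m} (E : SignalStructure S) {σ σ' : Strategy m} {θ : Nature}
    (h : ∀ i, σ.halt i θ = σ'.halt i θ) : endsAt P E σ θ = endsAt P E σ' θ := by
  have h1 := endProb_congr (P := P) h
  have h2 : ∀ t, aliveProb P E σ θ t = aliveProb P E σ' θ t := by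
    intro t
    induction t with
    | zero => rfl
    | succ t ih =>
      funext j
      simp only [aliveProb, ih, h1]
  funext i
  simp only [endsAt, h1, h2]

lemma hasSum_endsAt_mul (P : Protocol S m) (E : SignalStructure S) (σ : Strategy m) (θ : Nature)
    (r : Fin m → ℝ) :
    HasSum (fun t => ∑ i, aliveProb P E σ θ t i * endProb P σ θ i * r i)
      (∑ i, endsAt P E σ θ i * r i) :=
  hasSum_sum fun i _ => (summable_endsAt P E σ θ i).hasSum.mul_right (r i)

lemma aliveProb_succ_dotProduct (P : Protocol S m) (E : SignalStructure S) (σ : Strategy m)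
    (θ : Nature) (t : ℕ) (v : Fin m → ℝ) :
    aliveProb P E σ θ (t + 1) ⬝ᵥ v =
      ∑ i, aliveProb P E σ θ t i * (1 - endProb P σ θ i) * (P.trans E θ *ᵥ v) i := by
  simp only [dotProduct, mulVec, aliveProb, Finset.sum_mul, Finset.mul_sum]
  rw [Finset.sum_comm]
  simp only [mul_assoc]

lemma endsAt_nonneg (P : Protocol S m) (E : SignalStructure S) (σ : Strategy m) (θ : Nature)
    (i : Fin m) : 0 ≤ endsAt P E σ θ i :=
  tsum_nonneg fun t => mul_nonneg (aliveProb_nonneg P E σ θ t i) (endProb_mem P σ θ i).1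

/-- A superharmonic majorant of the stopping reward bounds the value of every strategy. -/
lemma sum_endsAt_mul_le {P : Protocol S m} {E : SignalStructure S} {θ : Nature}
    (σ : Strategy m) {r v : Fin m → ℝ} (hv0 : ∀ i, 0 ≤ v i) (hrv : ∀ i, r i ≤ v i)
    (hv : ∀ i, (P.trans E θ *ᵥ v) i ≤ v i) :
    ∑ i, endsAt P E σ θ i * r i ≤ P.g ⬝ᵥ v := by
  refine le_of_tendsto (hasSum_endsAt_mul P E σ θ r).tendsto_sum_nat (Eventually.of_forall ?_)
  intro n
  -- Supermartingale bound: the reward already collected plus `v` of the surviving mass never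
  -- increases.
  suffices h : aliveProb P E σ θ n ⬝ᵥ v + ∑ t ∈ Finset.range n,
      ∑ i, aliveProb P E σ θ t i * endProb P σ θ i * r i ≤ P.g ⬝ᵥ v by
    have : 0 ≤ aliveProb P E σ θ n ⬝ᵥ v :=
      Finset.sum_nonneg fun i _ => mul_nonneg (aliveProb_nonneg P E σ θ n i) (hv0 i)
    linarith
  induction n with
  | zero => simp [aliveProb]
  | succ n ih =>
    refine le_trans ?_ ih
    rw [Finset.sum_range_succ, aliveProb_succ_dotProduct]
    have : ∑ i, aliveProb P E σ θ n i * (1 - endProb P σ θ i) * (P.trans E θ *ᵥ v) i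
        + ∑ i, aliveProb P E σ θ n i * endProb P σ θ i * r i ≤ aliveProb P E σ θ n ⬝ᵥ v := by
      rw [← Finset.sum_add_distrib]
      refine Finset.sum_le_sum fun i _ => ?_
      have h1 := aliveProb_nonneg P E σ θ n i
      have h2 := endProb_mem P σ θ i
      have h3 := mul_le_mul_of_nonneg_left (hv i)
        (mul_nonneg h1 (sub_nonneg.2 h2.2))
      have h4 := mul_le_mul_of_nonneg_left (hrv i) (mul_nonneg h1 h2.1)
      linarith
    linarith

/-- A strategy that stops exactly on `T`, where `T` is reached from everywhere, has the harmonic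
extension of the reward as its value. -/
lemma sum_endsAt_mul_eq {P : Protocol S m} {E : SignalStructure S} {θ : Nature}
    {σ : Strategy m} {T : Set (Fin m)} (hT : Reaches (P.trans E θ) T)
    (h1 : ∀ i ∈ T, endProb P σ θ i = 1) (h0 : ∀ i ∉ T, endProb P σ θ i = 0)
    {r w : Fin m → ℝ} (hw : Harmonic (P.trans E θ) T r w) :
    ∑ i, endsAt P E σ θ i * r i = P.g ⬝ᵥ w := by
  classical
  have hK := P.trans_stochastic E θ
  obtain ⟨τ, hτ0, hτT, hτ⟩ := hK.exists_hitting_time hT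
  -- `μ t` is the mass surviving period `t`. Its sum is bounded by the expected hitting time, so it
  -- vanishes in the limit, and the optional-stopping identity `hpart` loses its boundary term.
  let μ : ℕ → ℝ := fun t => ∑ i, aliveProb P E σ θ t i * (1 - endProb P σ θ i)
  have hμ0 : ∀ t, 0 ≤ μ t := fun t => Finset.sum_nonneg fun i _ =>
    mul_nonneg (aliveProb_nonneg P E σ θ t i) (sub_nonneg.2 (endProb_mem P σ θ i).2)
  have hμs : Summable μ := by
    refine summable_of_sum_range_le (c := P.g ⬝ᵥ τ) hμ0 fun n => ?_
    suffices h : aliveProb P E σ θ n ⬝ᵥ τ + ∑ t ∈ Finset.range n, μ t = P.g ⬝ᵥ τ by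
      have : 0 ≤ aliveProb P E σ θ n ⬝ᵥ τ :=
        Finset.sum_nonneg fun i _ => mul_nonneg (aliveProb_nonneg P E σ θ n i) (hτ0 i)
      linarith
    induction n with
    | zero => simp [aliveProb]
    | succ n ih =>
      have hstep : ∑ i, aliveProb P E σ θ n i * (1 - endProb P σ θ i) * (P.trans E θ *ᵥ τ) i + μ n
          = aliveProb P E σ θ n ⬝ᵥ τ := by
        simp only [μ, dotProduct]
        rw [← Finset.sum_add_distrib]
        refine Finset.sum_congr rfl fun i _ => ?_
        by_cases hi : i ∈ T
        · simp [h1 i hi, hτT i hi]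
        · rw [h0 i hi, hτ i hi]; ring
      rw [Finset.sum_range_succ, aliveProb_succ_dotProduct]
      linarith
  have hpart : ∀ n, aliveProb P E σ θ n ⬝ᵥ w + ∑ t ∈ Finset.range n,
      ∑ i, aliveProb P E σ θ t i * endProb P σ θ i * r i = P.g ⬝ᵥ w := by
    intro n
    induction n with
    | zero => simp [aliveProb]
    | succ n ih =>
      have hstep : ∑ i, aliveProb P E σ θ n i * (1 - endProb P σ θ i) * (P.trans E θ *ᵥ w) i
          + ∑ i, aliveProb P E σ θ n i * endProb P σ θ i * r i = aliveProb P E σ θ n ⬝ᵥ w := by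
        simp only [dotProduct]
        rw [← Finset.sum_add_distrib]
        refine Finset.sum_congr rfl fun i _ => ?_
        by_cases hi : i ∈ T
        · simp [h1 i hi, hw.1 i hi]
        · rw [h0 i hi, ← hw.2 i hi]; ring
      rw [Finset.sum_range_succ, aliveProb_succ_dotProduct]
      linarith
  have hmass : ∀ t, ∑ i, aliveProb P E σ θ (t + 1) i = μ t := fun t => by
    have := aliveProb_succ_dotProduct P E σ θ t fun _ => 1
    simpa [dotProduct, hK.mulVec_const] using this
  have hlim : Tendsto (fun n => aliveProb P E σ θ n ⬝ᵥ w) atTop (𝓝 0) := by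
    have hi : ∀ i, Tendsto (fun n => aliveProb P E σ θ n i) atTop (𝓝 0) := fun i => by
      rw [← tendsto_add_atTop_iff_nat 1]
      refine squeeze_zero (fun n => aliveProb_nonneg P E σ θ _ i) (fun n => ?_)
        hμs.tendsto_atTop_zero
      rw [← hmass]
      exact Finset.single_le_sum (f := aliveProb P E σ θ (n + 1))
        (fun j _ => aliveProb_nonneg P E σ θ _ j) (Finset.mem_univ i)
    simpa [dotProduct] using tendsto_finsetSum Finset.univ fun i _ => (hi i).mul_const (w i)
  have hsum := (hlim.add (hasSum_endsAt_mul P E σ θ r).tendsto_sum_nat)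
  simp only [hpart, zero_add] at hsum
  exact tendsto_nhds_unique hsum tendsto_const_nhds

lemma sum_endsAt_le_one (P : Protocol S m) (E : SignalStructure S) (σ : Strategy m)
    (θ : Nature) : ∑ i, endsAt P E σ θ i ≤ 1 := by
  have hK := P.trans_stochastic E θ
  have := sum_endsAt_mul_le (P := P) (E := E) (θ := θ) σ (r := fun _ => 1) (v := fun _ => 1)
    (fun _ => zero_le_one) (fun _ => le_rfl) fun i => (hK.mulVec_const 1 i).le
  simpa [dotProduct, P.g_sum] using this

lemma probH_mem (P : Protocol S m) (E : SignalStructure S) (σ : Strategy m) (θ : Nature) :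
    probH P E σ θ ∈ Set.Icc (0 : ℝ) 1 := by
  refine ⟨Finset.sum_nonneg fun i _ => mul_nonneg (endsAt_nonneg P E σ θ i) (P.a_mem i).1,
    le_trans (Finset.sum_le_sum fun i _ => ?_) (sum_endsAt_le_one P E σ θ)⟩
  exact mul_le_of_le_one_right (endsAt_nonneg P E σ θ i) (P.a_mem i).2

lemma senderPayoff_eq (p : ℝ) (E : SignalStructure S) (P : Protocol S m) (σ : Strategy m) :
    senderPayoff p E P σ = p * probH P E σ Nature.H + (1 - p) * probH P E σ Nature.L := rfl

lemma receiverPayoff_eq (p : ℝ) (E : SignalStructure S) (P : Protocol S m) (σ : Strategy m) :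
    receiverPayoff p E P σ = p * probH P E σ Nature.H
      + (1 - p) * (∑ i, endsAt P E σ Nature.L i - probH P E σ Nature.L) := by
  simp only [receiverPayoff, probH, mul_sub, mul_one, Finset.sum_sub_distrib]

/-- The slack is the probability of endless play in state L, which pays the receiver nothing. -/
lemma receiverPayoff_le {p : ℝ} (hp : p ≤ 1) (E : SignalStructure S) (P : Protocol S m)
    (σ : Strategy m) :
    receiverPayoff p E P σ ≤ p * probH P E σ Nature.H + (1 - p) * (1 - probH P E σ Nature.L) := by
  rw [receiverPayoff_eq]
  have := sum_endsAt_le_one P E σ Nature.L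
  gcongr

lemma SignalStructure.nonempty (E : SignalStructure S) : Nonempty S := by
  by_contra h
  rw [not_nonempty_iff] at h
  have := E.prob_sum Nature.H
  simp at this

/-- Signals with extreme likelihood ratios. -/
lemma SignalStructure.exists_extreme (E : SignalStructure S) :
    ∃ sH sL : S, (∀ s, E.prob Nature.H s / E.prob Nature.L s
        ≤ E.prob Nature.H sH / E.prob Nature.L sH) ∧
      (∀ s, E.prob Nature.H sL / E.prob Nature.L sL ≤ E.prob Nature.H s / E.prob Nature.L s) ∧
      E.gamma = (E.prob Nature.H sH / E.prob Nature.L sH)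
        / (E.prob Nature.H sL / E.prob Nature.L sL) := by
  have := E.nonempty
  let f : S → ℝ := fun s => E.prob Nature.H s / E.prob Nature.L s
  obtain ⟨sH, hH⟩ := exists_eq_ciSup_of_finite (f := f)
  obtain ⟨sL, hL⟩ := exists_eq_ciInf_of_finite (f := f)
  refine ⟨sH, sL, fun s => ?_, fun s => ?_, ?_⟩
  · exact (le_ciSup (Set.finite_range f).bddAbove s).trans hH.ge
  · exact hL.le.trans (ciInf_le (Set.finite_range f).bddBelow s)
  · change (⨆ s, f s) / (⨅ s, f s) = f sH / f sL
    rw [hH, hL]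

/-- The odds of action `H` in state `H`, relative to those in state `L`, are at most
`γ ^ (m - 2)` when the sender best responds. -/
lemma oddsLe_of_bestResponse {p : ℝ} (hp1 : p < 1) (E : SignalStructure S)
    (P : Protocol S m) {σ : Strategy m} (hσ : σ ∈ bestResponses p E P) :
    OddsLe (E.gamma ^ (m - 2)) (probH P E σ Nature.H) (probH P E σ Nature.L) := by
  classical
  obtain ⟨sH, sL, hmax, hmin, hγ⟩ := E.exists_extreme
  set hi := E.prob Nature.H sH / E.prob Nature.L sH
  set lo := E.prob Nature.H sL / E.prob Nature.L sL
  have hlo : 0 < lo := div_pos (E.prob_pos _ _) (E.prob_pos _ _)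
  have hlohi : lo ≤ hi := hmin sH
  have hγ1 : 1 ≤ E.gamma := by rw [hγ]; exact (one_le_div hlo).2 hlohi
  have hKH := P.trans_stochastic E Nature.H
  have hKL := P.trans_stochastic E Nature.L
  have hl : ∀ i j, lo * P.trans E Nature.L i j ≤ P.trans E Nature.H i j := fun i j => by
    simp only [Protocol.trans, of_apply, Finset.mul_sum, ← mul_assoc]
    exact Finset.sum_le_sum fun s _ => mul_le_mul_of_nonneg_right
      ((le_div_iff₀ (E.prob_pos _ s)).1 (hmin s)) (P.f_nonneg i s j)
  have hh : ∀ i j, P.trans E Nature.H i j ≤ hi * P.trans E Nature.L i j := fun i j => by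
    simp only [Protocol.trans, of_apply, Finset.mul_sum, ← mul_assoc]
    exact Finset.sum_le_sum fun s _ => mul_le_mul_of_nonneg_right
      ((div_le_iff₀ (E.prob_pos _ s)).1 (hmax s)) (P.f_nonneg i s j)
  have ha0 := fun i => (P.a_mem i).1
  have ha1 := fun i => (P.a_mem i).2
  obtain ⟨v, hav, hvK, hT, hv⟩ := hKH.exists_value ha1
  set T : Set (Fin m) := {i | v i = P.a i}
  have hTL : Reaches (P.trans E Nature.L) T := hT.mono subset_rfl fun i j hij => by
    have h1 := hh i j
    by_contra! h2
    have := mul_nonpos_of_nonneg_of_nonpos (hlo.le.trans hlohi) h2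
    linarith
  obtain ⟨w, hw⟩ := hKL.exists_harmonic hTL P.a
  -- The deviation: unchanged in H, but in L stop exactly where stopping is optimal in H.
  let σ' : Strategy m :=
    { halt := fun i θ => match θ with
        | Nature.H => σ.halt i Nature.H
        | Nature.L => if i ∈ T then 1 else 0
      halt_mem := fun i θ => by
        cases θ
        · exact σ.halt_mem i _
        · by_cases h : i ∈ T <;> simp [h] }
  have hL' : probH P E σ' Nature.L = P.g ⬝ᵥ w := by
    refine sum_endsAt_mul_eq hTL (fun i hi => ?_) (fun i hi => ?_) hw
    · by_cases h : P.Absorbing i <;> simp [endProb, h, σ', hi]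
    · have : ¬ P.Absorbing i := fun h => hi (h.mem_of_reaches hT)
      simp [endProb, this, σ', hi]
  have hH' : probH P E σ' Nature.H = probH P E σ Nature.H := by
    simp only [probH, endsAt_congr E (σ := σ') (σ' := σ) (θ := Nature.H) fun i => rfl]
  have hL : P.g ⬝ᵥ w ≤ probH P E σ Nature.L := by
    have := hσ σ'
    rw [senderPayoff_eq, senderPayoff_eq, hH', hL'] at this
    have h1 : (1 - p) * (P.g ⬝ᵥ w) ≤ (1 - p) * probH P E σ Nature.L := by linarith
    exact le_of_mul_le_mul_left h1 (by linarith)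
  have hH : probH P E σ Nature.H ≤ P.g ⬝ᵥ v :=
    sum_endsAt_mul_le σ (fun i => (ha0 i).trans (hav i)) hav hvK
  have hX : P.g ⬝ᵥ v ∈ Set.Icc (0 : ℝ) 1 := dotProduct_mem_Icc P.g_nonneg P.g_sum
    (fun i => (ha0 i).trans (hav i)) (hv.le_one hKH hT fun i _ => ha1 i)
  have hY : P.g ⬝ᵥ w ∈ Set.Icc (0 : ℝ) 1 := dotProduct_mem_Icc P.g_nonneg P.g_sum
    (hw.nonneg hKL hTL fun i _ => ha0 i) (hw.le_one hKL hTL fun i _ => ha1 i)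
  have main : OddsLe (E.gamma ^ (m - 2)) (P.g ⬝ᵥ v) (P.g ⬝ᵥ w) := by
    have hpow : ∀ k, 1 ≤ E.gamma ^ k := fun k => one_le_pow₀ hγ1
    -- With at most one exit state the reward on `T` is constant and both values coincide. Otherwise
    -- at most `m - 2` states lie off `T`.
    rcases le_or_gt (T.ncard) 1 with hcard | hcard
    · have hconst : ∃ c, ∀ i ∈ T, P.a i = c := by
        rcases T.eq_empty_or_nonempty with h | ⟨i, hi⟩
        · exact ⟨0, by simp [h]⟩
        · exact ⟨P.a i, fun j hj => by rw [(Set.ncard_le_one_iff).1 hcard hj hi]⟩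
      obtain ⟨c, hc⟩ := hconst
      have e1 : v = fun _ => c := hv.eq hKH hT
        ⟨fun i hi => (hc i hi).symm, fun i _ => (hKH.mulVec_const c i).symm⟩
      have e2 : w = fun _ => c := hw.eq hKL hTL
        ⟨fun i hi => (hc i hi).symm, fun i _ => (hKL.mulVec_const c i).symm⟩
      rw [e1] at hX ⊢
      rw [e2]
      exact le_mul_of_one_le_left (mul_nonneg hX.1 (sub_nonneg.2 hX.2)) (hpow _)
    · have h1 := oddsLe_pow hKH hKL hT hlo hlohi hl hh ha0 ha1 hv hw P.g_nonneg P.g_sum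
      rw [← hγ] at h1
      have h2 : (Tᶜ).ncard ≤ m - 2 := by
        have := Set.ncard_add_ncard_compl T
        simp only [Nat.card_eq_fintype_card, Fintype.card_fin] at this
        omega
      refine le_trans h1 (mul_le_mul_of_nonneg_right (pow_le_pow_right₀ hγ1 h2) ?_)
      exact mul_nonneg hY.1 (sub_nonneg.2 hX.2)
  have hp2 := probH_mem P E σ Nature.H
  have hp3 := probH_mem P E σ Nature.L
  have hG : 0 ≤ E.gamma ^ (m - 2) := pow_nonneg (by linarith) _
  unfold OddsLe at *
  calc _ ≤ (P.g ⬝ᵥ v) * (1 - P.g ⬝ᵥ w) :=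
        mul_le_mul hH (by linarith) (sub_nonneg.2 hp3.2) hX.1
    _ ≤ _ := main
    _ ≤ _ := mul_le_mul_of_nonneg_left
        (mul_le_mul hL (by linarith) (sub_nonneg.2 hX.2) hp3.1) hG

end Game

/-! ### Parsimonious protocols close to the bound -/

section Construction

open Matrix

/-- Yields transience. As `T` is absorbing, the hitting time satisfies `K τ = τ - u` everywhere,
with `u` the indicator of the complement of `T`. Expected visits off `T` thus telescope to at most
`τ i`. -/
lemma Stochastic.summable_pow_apply {ι : Type*} [Fintype ι] [DecidableEq ι] {K : Matrix ι ι ℝ}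
    (hK : Stochastic K) {T : Set ι} (hT : Reaches K T) (habs : ∀ i ∈ T, ∀ j ≠ i, K i j = 0)
    {i : ι} (hi : i ∉ T) : Summable fun n : ℕ => (K ^ n) i i := by
  classical
  obtain ⟨τ, hτ0, hτT, hτ⟩ := hK.exists_hitting_time hT
  let u : ι → ℝ := fun j => if j ∈ T then 0 else 1
  have hKτ : K *ᵥ τ = τ - u := by
    funext j
    by_cases hj : j ∈ T
    · simp only [Pi.sub_apply, u, hj, if_true, hτT j hj, sub_zero]
      refine Finset.sum_eq_zero fun l _ => ?_
      by_cases hl : l = j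
      · rw [hl, hτT j hj, mul_zero]
      · simp [habs j hj l hl]
    · simp only [Pi.sub_apply, u, hj, if_false]
      rw [hτ j hj]; ring
  have hpow : ∀ (n : ℕ) (j l : ι), 0 ≤ (K ^ n) j l := by
    intro n
    induction n with
    | zero => intro j l; rw [pow_zero, one_apply]; split_ifs <;> simp
    | succ n ih =>
      intro j l
      rw [pow_succ, mul_apply]
      exact Finset.sum_nonneg fun k _ => mul_nonneg (ih j k) (hK.1 k l)
  have hsum : ∀ n, (K ^ n *ᵥ τ) i + ∑ k ∈ Finset.range n, (K ^ k *ᵥ u) i = τ i := by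
    intro n
    induction n with
    | zero => simp
    | succ n ih =>
      have : (K ^ (n + 1) *ᵥ τ) i = (K ^ n *ᵥ τ) i - (K ^ n *ᵥ u) i := by
        rw [pow_succ, ← mulVec_mulVec, hKτ, mulVec_sub, Pi.sub_apply]
      rw [Finset.sum_range_succ]
      linarith
  refine summable_of_sum_range_le (c := τ i) (fun n => hpow n i i) fun n => ?_
  have h1 : 0 ≤ (K ^ n *ᵥ τ) i :=
    Finset.sum_nonneg fun j _ => mul_nonneg (hpow n i j) (hτ0 j)
  have h2 : ∑ k ∈ Finset.range n, (K ^ k) i i ≤ ∑ k ∈ Finset.range n, (K ^ k *ᵥ u) i := by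
    refine Finset.sum_le_sum fun k _ => ?_
    have hu : (K ^ k) i i = (K ^ k) i i * u i := by simp [u, hi]
    rw [hu]
    exact Finset.single_le_sum (f := fun j => (K ^ k) i j * u j)
      (fun j _ => mul_nonneg (hpow k i j) (by by_cases h : j ∈ T <;> simp [u, h]))
      (Finset.mem_univ i)
  linarith [hsum n]

variable {S : Type*} {m : ℕ}

/-- The strategy that never stops. -/
def Strategy.neverStop (m : ℕ) : Strategy m where
  halt _ _ := 0
  halt_mem _ _ := by simp

/-- If action `H` is only ever taken at absorbing states, never stopping is a best response. -/
lemma neverStop_mem_bestResponses [Fintype S] {p : ℝ} (hp0 : 0 ≤ p) (hp1 : p ≤ 1)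
    (E : SignalStructure S) {P : Protocol S m} (ha : ∀ i, ¬ P.Absorbing i → P.a i = 0) :
    Strategy.neverStop m ∈ bestResponses p E P := by
  intro σ
  have hend : ∀ θ i, endProb P (Strategy.neverStop m) θ i ≤ endProb P σ θ i := fun θ i => by
    by_cases h : P.Absorbing i
    · simp [endProb, h]
    · simpa [endProb, h, Strategy.neverStop] using (σ.halt_mem i θ).1
  -- Stopping early only removes mass from the chain, and only absorbing states pay.
  have halive : ∀ θ t i, aliveProb P E σ θ t i
      ≤ aliveProb P E (Strategy.neverStop m) θ t i := by
    intro θ t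
    induction t with
    | zero => exact fun _ => le_rfl
    | succ t ih =>
      refine fun j => Finset.sum_le_sum fun i _ => ?_
      refine mul_le_mul_of_nonneg_right ?_ (trans_nonneg P E θ i j)
      exact mul_le_mul (ih i) (sub_le_sub_left (hend θ i) 1)
        (sub_nonneg.2 (endProb_mem P σ θ i).2) (aliveProb_nonneg P E _ θ t i)
  have hprob : ∀ θ, probH P E σ θ ≤ probH P E (Strategy.neverStop m) θ := by
    refine fun θ => Finset.sum_le_sum fun i _ => ?_
    by_cases h : P.Absorbing i
    · refine mul_le_mul_of_nonneg_right ?_ (P.a_mem i).1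
      refine (summable_endsAt P E σ θ i).tsum_le_tsum (fun t => ?_)
        (summable_endsAt P E _ θ i)
      simpa [endProb, h] using halive θ t i
    · simp [ha i h]
  rw [senderPayoff_eq, senderPayoff_eq]
  have := hprob Nature.H
  have := hprob Nature.L
  have : 0 ≤ 1 - p := by linarith
  gcongr

/-- The protocol that starts at `start`, moves upon signal `s` from `i` to `dest i s` with
probability `rate i s` and stays put otherwise, and takes action `H` at `top` only. -/
def Protocol.jump (start top : Fin m) (rate : Fin m → S → ℝ) (dest : Fin m → S → Fin m)
    (hrate : ∀ i s, rate i s ∈ Set.Icc (0 : ℝ) 1) : Protocol S m where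
  f i s j := rate i s * (if j = dest i s then 1 else 0) + (1 - rate i s) * (if j = i then 1 else 0)
  f_nonneg i s j := by
    have h1 := (hrate i s).1
    have h2 := sub_nonneg.2 (hrate i s).2
    positivity
  f_sum i s := by simp [Finset.sum_add_distrib]
  g j := if j = start then 1 else 0
  g_nonneg j := by positivity
  g_sum := by simp
  a j := if j = top then 1 else 0
  a_mem j := by by_cases h : j = top <;> simp [h]

lemma Protocol.jump_trans_mulVec [Fintype S] (start top : Fin m) (rate : Fin m → S → ℝ)
    (dest : Fin m → S → Fin m) (hrate : ∀ i s, rate i s ∈ Set.Icc (0 : ℝ) 1)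
    (E : SignalStructure S) (θ : Nature) (w : Fin m → ℝ) (i : Fin m) :
    ((Protocol.jump start top rate dest hrate).trans E θ *ᵥ w) i
      = w i + ∑ s, E.prob θ s * (rate i s * (w (dest i s) - w i)) := by
  have h1 : ∀ s, ∑ j, (Protocol.jump start top rate dest hrate).f i s j * w j
      = w i + rate i s * (w (dest i s) - w i) := fun s => by
    simp only [Protocol.jump, add_mul, mul_assoc, Finset.sum_add_distrib, ← Finset.mul_sum,
      ite_mul, one_mul, zero_mul, Finset.sum_ite_eq', Finset.mem_univ, if_true]
    ring
  simp only [mulVec, dotProduct, Protocol.trans, of_apply, Finset.sum_mul]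
  rw [Finset.sum_comm]
  simp only [mul_assoc, ← Finset.mul_sum, h1]
  simp only [mul_add, Finset.sum_add_distrib, ← Finset.sum_mul, E.prob_sum, one_mul]

/-- A parsimonious protocol: states `1, …, N + 1` are climbed by consecutive signals `sH`, signals
`sL` lead back to state `1`, and from there to `0`. The parameters `ε` and `c` govern the
probabilities with which signals are disregarded. -/
lemma exists_climbing_protocol [Fintype S] {p : ℝ} (hp0 : 0 ≤ p) (hp1 : p ≤ 1)
    (E : SignalStructure S) {sH sL : S} (hne : sH ≠ sL) (N : ℕ) {c ε : ℝ} (hc : 0 < c)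
    (hε0 : 0 < ε) (hε1 : ε ≤ 1) :
    ∃ (P : Protocol S (N + 3)) (σ : Strategy (N + 3)), P.Parsimonious E ∧
      σ ∈ bestResponses p E P ∧ ∀ θ, ∑ i, endsAt P E σ θ i = 1 ∧ ∃ o : ℝ,
        o = E.prob θ sH / E.prob θ sL / c *
          (E.prob θ sH / E.prob θ sL / (ε * (E.prob θ sH / E.prob θ sL) + 1)) ^ N ∧
        probH P E σ θ = o / (1 + o) := by
  classical
  let top : Fin (N + 3) := Fin.last (N + 2)
  let start : Fin (N + 3) := 1
  let T : Set (Fin (N + 3)) := {0, top}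
  -- At state 1, climbing and dropping to 0 are accepted in proportion `1` to `c * ε ^ N`, which
  -- matches the order of the chance of `N` further climbs. The factor `1 / (1 + c)` only keeps both
  -- rates at most 1.
  let rate : Fin (N + 3) → S → ℝ := fun i s =>
    if i ∈ T then 0
    else if s = sH then (if i.val = 1 then 1 / (1 + c) else ε)
    else if s = sL then (if i.val = 1 then 1 / (1 + c) * (c * ε ^ N) else 1)
    else 0
  let dest : Fin (N + 3) → S → Fin (N + 3) := fun i s =>
    if s = sH then ⟨min (i.val + 1) (N + 2), by omega⟩ else if i.val ≤ 1 then 0 else 1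
  have hη0 : 0 < 1 / (1 + c) := by positivity
  have hη1 : 1 / (1 + c) ≤ 1 := by rw [div_le_one (by positivity)]; linarith
  have hη2 : 1 / (1 + c) * (c * ε ^ N) ≤ 1 := by
    have : ε ^ N ≤ 1 := pow_le_one₀ hε0.le hε1
    rw [div_mul_eq_mul_div, one_mul, div_le_one (by positivity)]
    nlinarith
  have hη3 : 0 ≤ 1 / (1 + c) * (c * ε ^ N) := by positivity
  have hrate : ∀ i s, rate i s ∈ Set.Icc (0 : ℝ) 1 := by
    intro i s
    simp only [rate]
    split_ifs <;> constructor <;> first | assumption | exact hη0.le | exact hε0.le | norm_num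
  let P := Protocol.jump start top rate dest hrate
  have hmem : ∀ {i : Fin (N + 3)}, i ∉ T → i.val ≠ 0 ∧ i.val ≠ N + 2 := fun {i} hi => by
    simp only [T, Set.mem_insert_iff, Set.mem_singleton_iff, not_or, top, Fin.ext_iff,
      Fin.val_zero, Fin.val_last] at hi
    exact hi
  have habs : ∀ i ∈ T, P.Absorbing i := fun i hi s => by simp [P, Protocol.jump, rate, hi]
  have hreach : ∀ θ, Reaches (P.trans E θ) T := by
    intro θ C hC hCT
    obtain ⟨i, hiC, hi⟩ := C.toFinite.exists_maximalFor id C hC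
    have hiT : i ∉ T := Set.disjoint_left.1 hCT hiC
    obtain ⟨h0, h1⟩ := hmem hiT
    have hlt := i.isLt
    let j : Fin (N + 3) := ⟨min (i.val + 1) (N + 2), by omega⟩
    have hjv : j.val = i.val + 1 := by simp only [j]; omega
    refine ⟨i, hiC, j, fun hj => ?_, ?_⟩
    · have h2 : i ≤ j := by rw [Fin.le_def]; omega
      have h3 : j ≤ i := hi hj h2
      rw [Fin.le_def] at h3
      omega
    · have hpos : 0 < E.prob θ sH * P.f i sH j := by
        refine mul_pos (E.prob_pos θ sH) ?_
        have hr : 0 < rate i sH := by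
          simp only [rate, hiT, if_false, if_true]
          split_ifs <;> assumption
        have h4 : j ≠ i := fun h => by rw [h] at hjv; omega
        have h5 : j = dest i sH := by simp only [dest, if_true, j]
        change 0 < rate i sH * (if j = dest i sH then 1 else 0)
          + (1 - rate i sH) * (if j = i then 1 else 0)
        rw [if_pos h5, if_neg h4]
        linarith
      exact hpos.trans_le (Finset.single_le_sum (f := fun s => E.prob θ s * P.f i s j)
        (fun s _ => mul_nonneg (E.prob_pos θ s).le (P.f_nonneg i s j)) (Finset.mem_univ sH))
  have habs' : ∀ i, P.Absorbing i → i ∈ T := fun i h => h.mem_of_reaches (hreach Nature.H)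
  have htop0 : (0 : Fin (N + 3)) ≠ top := by simp [top, Fin.ext_iff]
  have ha : ∀ i, i ≠ top → P.a i = 0 := fun i hi => by simp [P, Protocol.jump, hi]
  refine ⟨P, Strategy.neverStop _, ⟨0, top, habs _ (by simp [T]), ha _ htop0,
    habs _ (by simp [T]), by simp [P, Protocol.jump], fun i h0 h1 => ⟨fun θ => ?_, ha i h1⟩⟩,
    neverStop_mem_bestResponses hp0 hp1 E fun i hi => ha i fun h => hi (habs i (by simp [h, T])),
    fun θ => ?_⟩
  · exact (P.trans_stochastic E θ).summable_pow_apply (hreach θ)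
      (fun j hj k hk => (habs j hj).trans_eq_zero E θ hk) (by simp [T, h0, h1])
  have hK := P.trans_stochastic E θ
  have e1 : ∀ i ∈ T, endProb P (Strategy.neverStop _) θ i = 1 := fun i hi => by
    simp [endProb, habs i hi]
  have e0 : ∀ i ∉ T, endProb P (Strategy.neverStop _) θ i = 0 := fun i hi => by
    have : ¬ P.Absorbing i := fun h => hi (habs' i h)
    simp [endProb, this, Strategy.neverStop]
  refine ⟨?_, ?_⟩
  · have := sum_endsAt_mul_eq (hreach θ) e1 e0 (r := fun _ => 1) (w := fun _ => 1)
      ⟨fun _ _ => rfl, fun i _ => (hK.mulVec_const 1 i).symm⟩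
    simpa [dotProduct, P.g_sum] using this
  set πH := E.prob θ sH with hπH
  set πL := E.prob θ sL with hπL
  have hH0 : 0 < πH := E.prob_pos θ sH
  have hL0 : 0 < πL := E.prob_pos θ sL
  let o : ℝ := πH / πL / c * (πH / πL / (ε * (πH / πL) + 1)) ^ N
  have ho : 0 ≤ o := by positivity
  refine ⟨o, rfl, ?_⟩
  -- `ρ` is the chance of climbing before being reset from a state above 1, and `x` that of ending
  -- at `top` from state 1. `hρ` and `hx` are the balance equations there.
  let ρ : ℝ := ε * πH / (ε * πH + πL)
  let x : ℝ := o / (1 + o)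
  have hρ : ε * πH * (1 - ρ) = πL * ρ := by
    simp only [ρ]; field_simp; ring
  have hx : πH * (ρ ^ N * (1 - x)) = πL * (c * ε ^ N) * x := by
    have h1 : ρ = ε * (πH / πL / (ε * (πH / πL) + 1)) := by
      simp only [ρ]; field_simp
    have h2 : πH * ρ ^ N = πL * (c * ε ^ N) * o := by
      rw [h1, mul_pow]
      simp only [o]
      field_simp
    have h3 : 1 - x = 1 / (1 + o) := by
      simp only [x]; field_simp; ring
    rw [← mul_assoc, h2, h3]
    simp only [x]; ring
  -- From `i ≥ 2`, either the remaining `N + 2 - i` climbs all succeed, or the chain is reset to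
  -- state 1, worth `x`.
  let W : ℕ → ℝ := fun i =>
    if i = 0 then 0 else if i = 1 then x else x + ρ ^ (N + 2 - i) * (1 - x)
  let w : Fin (N + 3) → ℝ := fun i => W i.val
  have hw : Harmonic (P.trans E θ) T P.a w := by
    refine ⟨fun i hi => ?_, fun i hi => ?_⟩
    · rcases hi with rfl | hi
      · simp [w, W, ha _ htop0]
      · obtain rfl : i = top := hi
        simp [w, W, top, P, Protocol.jump]
    · obtain ⟨h0, h1⟩ := hmem hi
      have hlt := i.isLt
      rw [Protocol.jump_trans_mulVec]
      suffices h : ∑ s, E.prob θ s * (rate i s * (w (dest i s) - w i)) = 0 by rw [h, add_zero]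
      rw [Finset.sum_eq_add sH sL hne (fun s _ hs => by simp [rate, hs.1, hs.2])
        (by simp) (by simp)]
      have hup : w (dest i sH) = W (i.val + 1) := by
        have : (dest i sH).val = i.val + 1 := by
          simp only [dest, if_true]; omega
        simp only [w, this]
      by_cases hi1 : i.val = 1
      · have r1 : rate i sH = 1 / (1 + c) := by simp [rate, hi, hi1]
        have r2 : rate i sL = 1 / (1 + c) * (c * ε ^ N) := by simp [rate, hi, hi1, hne.symm]
        have w1 : w (dest i sH) = x + ρ ^ N * (1 - x) := by
          rw [hup, hi1]; simp [W]
        have w2 : w (dest i sL) = 0 := by simp [w, W, dest, hne.symm, hi1]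
        have w3 : w i = x := by simp only [w, hi1]; simp [W]
        rw [r1, r2, w1, w2, w3]
        linear_combination (1 / (1 + c)) * hx
      · obtain ⟨k, hk⟩ : ∃ k, i.val + 1 + k = N + 2 := ⟨N + 2 - (i.val + 1), by omega⟩
        have r1 : rate i sH = ε := by simp [rate, hi, hi1]
        have r2 : rate i sL = 1 := by simp [rate, hi, hi1, hne.symm]
        have w1 : w (dest i sH) = x + ρ ^ k * (1 - x) := by
          have : N + 2 - (i.val + 1) = k := by omega
          rw [hup]
          simp only [W, this, if_neg (show i.val + 1 ≠ 0 by omega),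
            if_neg (show i.val + 1 ≠ 1 by omega)]
        have w2 : w (dest i sL) = x := by
          have : ¬ i.val ≤ 1 := by omega
          simp [w, W, dest, hne.symm, this]
        have w3 : w i = x + ρ ^ (k + 1) * (1 - x) := by
          have : N + 2 - i.val = k + 1 := by omega
          simp only [w, W, this, if_neg h0, if_neg hi1]
        rw [r1, r2, w1, w2, w3, pow_succ]
        linear_combination (ρ ^ k * (1 - x)) * hρ
  have := sum_endsAt_mul_eq (hreach θ) e1 e0 hw
  rw [probH, this]
  have hg : P.g ⬝ᵥ w = w start := by
    simp only [dotProduct, P, Protocol.jump, ite_mul, one_mul, zero_mul, Finset.sum_ite_eq',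
      Finset.mem_univ, if_true]
  rw [hg]
  simp [w, W, start, x]

end Construction

/-! ### The receiver's problem and the sender's limit -/

section Value

/-- The sender's limiting payoff, as a function of the prior and of `Γ = γ ^ (m - 2)`. -/
noncomputable def senderLimit (p Γ : ℝ) : ℝ := p + (2 * p - 1) / (Γ - 1)

lemma one_le_kappa {p : ℝ} (hp0 : 0 < p) (hp1 : p < 1) : 1 ≤ kappa p := by
  have hq : 0 < 1 - p := by linarith
  rcases le_total p (1 - p) with h | h
  · exact ((one_le_div hp0).2 h).trans (le_max_right _ _)
  · exact ((one_le_div hq).2 h).trans (le_max_left _ _)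

/-- The receiver's loss, relative to the maximum over all pairs of action probabilities that
satisfy the odds bound. -/
lemma receiver_loss {p Γ k D X Y : ℝ} (hp0 : 0 < p) (hp1 : p < 1) (hΓ : 1 < Γ)
    (hk : k ^ 2 * p = Γ * (1 - p)) (hD : D = Γ - (Γ - 1) * X) (hX0 : 0 ≤ X) (hX1 : X ≤ 1)
    (h : OddsLe Γ X Y) :
    X ≤ Y * D ∧ p * (D - k) ^ 2 / (Γ * (Γ - 1)) + (1 - p) * (Y - X / D)
      ≤ (Γ - 2 * p * k) / (Γ - 1) - (p * X + (1 - p) * (1 - Y)) := by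
  have hD1 : 1 ≤ D := by rw [hD]; nlinarith
  have hDΓ : D ≤ Γ := by rw [hD]; nlinarith
  have hD0 : 0 < D := by linarith
  have hΓ1 : 0 < Γ - 1 := by linarith
  refine ⟨?_, ?_⟩
  · unfold OddsLe at h
    rw [hD]
    linarith
  · have hX : X = (Γ - D) / (Γ - 1) := by
      rw [hD]; field_simp; ring
    -- Completing the square in `D`; `hk` is the first-order condition at `D = k`. Bounding `D` by
    -- `Γ` in the denominator then frees the coefficient from `X`.
    have key : (Γ - 2 * p * k) / (Γ - 1) - (p * X + (1 - p) * (1 - Y))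
        = p * (D - k) ^ 2 / (D * (Γ - 1)) + (1 - p) * (Y - X / D) := by
      rw [hX]
      field_simp
      linear_combination -hk
    rw [key]
    gcongr

/-- Both terms of the loss are nonnegative and squeezed by the receiver's vanishing gap: the first
pins down `D`, hence `X`, and the second forces `Y` towards `X / D`. -/
lemma tendsto_payoff_of_loss {p Γ k : ℝ} (hp0 : 0 < p) (hp1 : p < 1) (hΓ : 1 < Γ) (hk0 : 0 < k)
    (hk : k ^ 2 * p = Γ * (1 - p)) {X Y R : ℕ → ℝ} (hX0 : ∀ n, 0 ≤ X n) (hX1 : ∀ n, X n ≤ 1)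
    (h : ∀ n, OddsLe Γ (X n) (Y n)) (hR : ∀ n, R n ≤ p * X n + (1 - p) * (1 - Y n))
    (hlim : Tendsto R atTop (𝓝 ((Γ - 2 * p * k) / (Γ - 1)))) :
    Tendsto (fun n => p * X n + (1 - p) * Y n) atTop (𝓝 (senderLimit p Γ)) := by
  have hΓ1 : 0 < Γ - 1 := by linarith
  have hΓ0 : 0 < Γ := by linarith
  have hq : 0 < 1 - p := by linarith
  set v := (Γ - 2 * p * k) / (Γ - 1) with hv
  let D : ℕ → ℝ := fun n => Γ - (Γ - 1) * X n
  have hD0 : ∀ n, 0 < D n := fun n => by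
    have := hX1 n
    simp only [D]
    nlinarith
  have hloss := fun n => receiver_loss hp0 hp1 hΓ hk (D := D n) rfl (hX0 n) (hX1 n) (h n)
  have hgap : Tendsto (fun n => v - R n) atTop (𝓝 0) := by
    simpa using hlim.const_sub v
  have hA : ∀ n, 0 ≤ p * (D n - k) ^ 2 / (Γ * (Γ - 1)) := fun n => by positivity
  have hB : ∀ n, 0 ≤ Y n - X n / D n := fun n =>
    sub_nonneg.2 ((div_le_iff₀ (hD0 n)).2 (hloss n).1)
  have hsq : Tendsto (fun n => (D n - k) ^ 2) atTop (𝓝 0) := by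
    refine squeeze_zero (fun n => sq_nonneg _) (fun n => ?_)
      (by simpa using hgap.mul_const (Γ * (Γ - 1) / p))
    have h1 : p * (D n - k) ^ 2 / (Γ * (Γ - 1)) ≤ v - R n := by
      have h2 := (hloss n).2
      have h3 := mul_nonneg hq.le (hB n)
      have h4 := hR n
      linarith
    calc (D n - k) ^ 2 = p * (D n - k) ^ 2 / (Γ * (Γ - 1)) * (Γ * (Γ - 1) / p) := by
          field_simp
      _ ≤ _ := by gcongr
  have hDk : Tendsto D atTop (𝓝 k) := by
    have h1 : Tendsto (fun n => |D n - k|) atTop (𝓝 0) := by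
      simpa [Real.sqrt_sq_eq_abs] using hsq.sqrt
    have h2 := (tendsto_zero_iff_abs_tendsto_zero _).2 h1
    simpa using h2.add_const k
  have hXlim : Tendsto X atTop (𝓝 ((Γ - k) / (Γ - 1))) := by
    refine ((hDk.const_sub Γ).div_const (Γ - 1)).congr fun n => ?_
    simp only [D]; field_simp; ring
  have hYX : Tendsto (fun n => Y n - X n / D n) atTop (𝓝 0) := by
    refine squeeze_zero hB (fun n => ?_) (by simpa using hgap.div_const (1 - p))
    rw [le_div_iff₀ hq]
    have h2 := (hloss n).2
    have h3 := hA n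
    have h4 := hR n
    linarith
  have hYlim : Tendsto Y atTop (𝓝 ((Γ - k) / (Γ - 1) / k)) := by
    have := hYX.add (hXlim.div hDk hk0.ne')
    rw [zero_add] at this
    exact this.congr fun n => by simp
  have hfin := (hXlim.const_mul p).add (hYlim.const_mul (1 - p))
  convert hfin using 2
  unfold senderLimit
  field_simp
  linear_combination hk

variable {S : Type*} [Fintype S]

/-- Parsimonious protocols attain the receiver's bound in the limit. -/
lemma exists_approximating_protocols {p k Γ : ℝ} (hp0 : 0 < p) (hp1 : p < 1)
    (E : SignalStructure S) {m : ℕ} (hm : 3 ≤ m) (hΓ : Γ = E.gamma ^ (m - 2)) (hΓ1 : 1 < Γ)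
    (hk : k ^ 2 * p = Γ * (1 - p)) (hk1 : 1 < k) (hkΓ : k < Γ) :
    ∃ (P : ℕ → Protocol S m) (σ : ℕ → Strategy m), (∀ n, (P n).Parsimonious E) ∧
      (∀ n, σ n ∈ bestResponses p E (P n)) ∧
      Tendsto (fun n => receiverPayoff p E (P n) (σ n)) atTop
        (𝓝 ((Γ - 2 * p * k) / (Γ - 1))) := by
  obtain ⟨N, rfl⟩ : ∃ N, m = N + 3 := ⟨m - 3, by omega⟩
  have hN : N + 3 - 2 = N + 1 := rfl
  rw [hN] at hΓ
  obtain ⟨sH, sL, -, -, hγ⟩ := E.exists_extreme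
  have hne : sH ≠ sL := by
    rintro rfl
    rw [div_self (div_pos (E.prob_pos _ _) (E.prob_pos _ _)).ne'] at hγ
    rw [hγ, one_pow] at hΓ
    linarith
  obtain ⟨r, hrdef⟩ : ∃ r : Nature → ℝ, ∀ θ, r θ = E.prob θ sH / E.prob θ sL :=
    ⟨_, fun _ => rfl⟩
  have hr : ∀ θ, 0 < r θ := fun θ => by
    rw [hrdef]; exact div_pos (E.prob_pos _ _) (E.prob_pos _ _)
  have hγr : E.gamma = r Nature.H / r Nature.L := by
    rw [hγ, hrdef, hrdef]
    have := E.prob_pos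
    have h1 := this Nature.H sH
    have h2 := this Nature.H sL
    have h3 := this Nature.L sH
    have h4 := this Nature.L sL
    field_simp
  -- The odds of the optimal `X = (Γ - k) / (Γ - 1)`. The choice of `c` makes the limiting odds `A`
  -- in state H, hence `A / Γ` in state L; `ε = 1 / (n + 1)` tends to 0.
  let A : ℝ := (Γ - k) / (k - 1)
  have hk0 : 0 < k - 1 := by linarith
  have hA : 0 < A := div_pos (by linarith) hk0
  let c : ℝ := r Nature.H ^ (N + 1) / A
  have hc : 0 < c := div_pos (pow_pos (hr _) _) hA
  have hε0 : ∀ n : ℕ, (0 : ℝ) < 1 / ((n : ℝ) + 1) := fun n => by positivity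
  have hε1 : ∀ n : ℕ, 1 / ((n : ℝ) + 1) ≤ 1 := fun n => by
    rw [div_le_one (by positivity)]
    linarith [(Nat.cast_nonneg n : (0 : ℝ) ≤ n)]
  choose P σ hP hσ hθ using fun n : ℕ =>
    exists_climbing_protocol hp0.le hp1.le E hne N hc (hε0 n) (hε1 n)
  choose hend o ho hprob using hθ
  simp only [← hrdef] at ho
  refine ⟨P, σ, hP, hσ, ?_⟩
  have holim : ∀ θ, Tendsto (fun n => o n θ) atTop (𝓝 (r θ / c * (r θ) ^ N)) := fun θ => by
    have h1 : Tendsto (fun n : ℕ => r θ / (1 / ((n : ℝ) + 1) * r θ + 1)) atTop (𝓝 (r θ)) := by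
      have := (tendsto_one_div_add_atTop_nhds_zero_nat (𝕜 := ℝ)).mul_const (r θ)
      have := (tendsto_const_nhds (x := r θ)).div (this.add_const 1) (by simp)
      simpa [Pi.div_def] using this
    exact ((h1.pow N).const_mul (r θ / c)).congr fun n => (ho n θ).symm
  have hplim : ∀ θ, Tendsto (fun n => probH (P n) E (σ n) θ) atTop
      (𝓝 (r θ / c * (r θ) ^ N / (1 + r θ / c * (r θ) ^ N))) := fun θ => by
    have hpos : 0 < r θ / c * r θ ^ N :=
      mul_pos (div_pos (hr θ) hc) (pow_pos (hr θ) N)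
    simp only [hprob]
    exact (holim θ).div ((holim θ).const_add 1) (by positivity)
  have hoH : r Nature.H / c * r Nature.H ^ N = A := by
    have := hr Nature.H
    simp only [c]; field_simp; ring
  have hoL : r Nature.L / c * r Nature.L ^ N = A / Γ := by
    have h1 := hr Nature.H
    have h2 := hr Nature.L
    rw [hΓ, hγr, div_pow]
    simp only [c]; field_simp; ring
  have h1 := hplim Nature.H
  have h2 := hplim Nature.L
  rw [hoH] at h1
  rw [hoL] at h2
  have hfin := (h1.const_mul p).add ((h2.const_sub 1).const_mul (1 - p))
  have hΓ0 : 0 < Γ := by linarith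
  have hΓ1' : 0 < Γ - 1 := by linarith
  have e1 : A / (1 + A) = (Γ - k) / (Γ - 1) := by
    have : 1 + A = (Γ - 1) / (k - 1) := by simp only [A]; field_simp; ring
    rw [this]
    simp only [A]
    field_simp
  have e2 : A / Γ / (1 + A / Γ) = (Γ - k) / (k * (Γ - 1)) := by
    have hk0' : 0 < k := by linarith
    have : 1 + A / Γ = k * (Γ - 1) / (Γ * (k - 1)) := by simp only [A]; field_simp; ring
    rw [this]
    simp only [A]
    field_simp
  have e3 : p * (A / (1 + A)) + (1 - p) * (1 - A / Γ / (1 + A / Γ))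
      = (Γ - 2 * p * k) / (Γ - 1) := by
    have hk0' : 0 < k := by linarith
    rw [e1, e2]
    field_simp
    linear_combination hk
  rw [e3] at hfin
  refine hfin.congr fun n => ?_
  rw [receiverPayoff_eq, hend n Nature.L]

lemma isSenderLimit_senderLimit {p : ℝ} (hp0 : 0 < p) (hp1 : p < 1) (E : SignalStructure S)
    {m : ℕ} (hκ : kappa p < E.gamma ^ (m - 2)) :
    IsSenderLimit p E m (senderLimit p (E.gamma ^ (m - 2))) := by
  have hq : 0 < 1 - p := by linarith
  obtain ⟨Γ, hΓ⟩ : ∃ Γ, Γ = E.gamma ^ (m - 2) := ⟨_, rfl⟩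
  rw [← hΓ] at hκ ⊢
  have hΓ1 : 1 < Γ := (one_le_kappa hp0 hp1).trans_lt hκ
  have hΓ0 : 0 < Γ := by linarith
  have hm : 3 ≤ m := by
    by_contra! h
    have : m - 2 = 0 := by omega
    rw [this, pow_zero] at hΓ
    linarith
  have hκ1 : p / (1 - p) < Γ := (le_max_left _ _).trans_lt hκ
  have hκ2 : (1 - p) / p < Γ := (le_max_right _ _).trans_lt hκ
  rw [div_lt_iff₀ hq] at hκ1
  rw [div_lt_iff₀ hp0] at hκ2
  -- The two halves of `κ < Γ` give `1 < k` and `k < Γ`, so the optimal `X` lies strictly between 0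
  -- and 1.
  let k := Real.sqrt (Γ * (1 - p) / p)
  have hk0 : 0 ≤ k := Real.sqrt_nonneg _
  have hk2 : k ^ 2 = Γ * (1 - p) / p := Real.sq_sqrt (by positivity)
  have hk : k ^ 2 * p = Γ * (1 - p) := by rw [hk2]; field_simp
  have hk1 : 1 < k := by
    refine Real.lt_sqrt_of_sq_lt ?_
    rw [one_pow, lt_div_iff₀ hp0]
    linarith
  have hkΓ : k < Γ := by
    refine (Real.sqrt_lt' hΓ0).2 ?_
    rw [div_lt_iff₀ hp0]
    nlinarith
  obtain ⟨P, σ, hP, hσ, hlim⟩ := exists_approximating_protocols hp0 hp1 E hm hΓ hΓ1 hk hk1 hkΓ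
  have hodds : ∀ (P : Protocol S m) (σ : Strategy m), σ ∈ bestResponses p E P →
      OddsLe Γ (probH P E σ Nature.H) (probH P E σ Nature.L) := fun P σ h => by
    rw [hΓ]; exact oddsLe_of_bestResponse hp1 E P h
  have hbound : ∀ u ∈ {u : ℝ | ∃ P : Protocol S m, ∃ σ ∈ bestResponses p E P,
      u = receiverPayoff p E P σ}, u ≤ (Γ - 2 * p * k) / (Γ - 1) := by
    rintro u ⟨P, σ, h, rfl⟩
    have hX := probH_mem P E σ Nature.H
    obtain ⟨h1, h2⟩ := receiver_loss hp0 hp1 hΓ1 hk rfl hX.1 hX.2 (hodds P σ h)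
    set D := Γ - (Γ - 1) * probH P E σ Nature.H with hD
    have hD0 : 0 < D := by
      have := hX.2
      rw [hD]
      nlinarith
    have h3 : 0 ≤ (1 - p) * (probH P E σ Nature.L - probH P E σ Nature.H / D) :=
      mul_nonneg hq.le (sub_nonneg.2 ((div_le_iff₀ hD0).2 h1))
    have h4 : 0 ≤ p * (D - k) ^ 2 / (Γ * (Γ - 1)) := by
      have : 0 < Γ - 1 := by linarith
      positivity
    have h5 := receiverPayoff_le hp1.le E P σ
    linarith
  have hvalue : receiverValue p E m = (Γ - 2 * p * k) / (Γ - 1) := by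
    refine le_antisymm (csSup_le ⟨_, P 0, σ 0, hσ 0, rfl⟩ hbound) ?_
    exact le_of_tendsto hlim (Eventually.of_forall fun n =>
      le_csSup ⟨_, hbound⟩ ⟨P n, σ n, hσ n, rfl⟩)
  refine ⟨⟨P, σ, hP, hσ, by rwa [hvalue]⟩, fun P' σ' h => ?_⟩
  obtain ⟨-, hσ', hlim'⟩ := h
  rw [hvalue] at hlim'
  exact tendsto_payoff_of_loss hp0 hp1 hΓ1 (by linarith) hk
    (fun n => (probH_mem (P' n) E (σ' n) Nature.H).1)
    (fun n => (probH_mem (P' n) E (σ' n) Nature.H).2)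
    (fun n => hodds (P' n) (σ' n) (hσ' n))
    (fun n => receiverPayoff_le hp1.le E (P' n) (σ' n)) hlim'

lemma gammaRange_pow {p : ℝ} (hp0 : 0 < p) (hp1 : p < 1) {m : ℕ} {x : ℝ}
    (hx : x ∈ gammaRange p m) : m - 2 ≠ 0 ∧ 1 < x ^ (m - 2) := by
  have h := (one_le_kappa hp0 hp1).trans_lt hx.2
  refine ⟨fun h0 => ?_, h⟩
  rw [h0, pow_zero] at h
  exact lt_irrefl _ h

lemma gammaRange_pow_lt {p : ℝ} (hp0 : 0 < p) (hp1 : p < 1) {m : ℕ} {x y : ℝ}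
    (hx : x ∈ gammaRange p m) (hxy : x < y) : 1 / (y ^ (m - 2) - 1) < 1 / (x ^ (m - 2) - 1) := by
  obtain ⟨h0, h1⟩ := gammaRange_pow hp0 hp1 hx
  have h2 := pow_lt_pow_left₀ hxy (by linarith [hx.1]) h0
  exact one_div_lt_one_div_of_lt (by linarith) (by linarith)

end Value

end StrategicLearning

/-! ### Comparative statics in the informativeness -/

theorem mainTheorem6 (p : ℝ) (hp0 : 0 < p) (hp1 : p < 1) :
    ∃ V : ℕ → ℝ → ℝ,
      (∀ m : ℕ, 2 ≤ m → ∀ (S : Type*) [Fintype S] (E : StrategicLearning.SignalStructure S),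
        StrategicLearning.kappa p < E.gamma ^ (m - 2) →
          StrategicLearning.IsSenderLimit p E m (V m E.gamma)) ∧
      (p < 1 / 2 → ∀ m : ℕ, 2 ≤ m →
        StrictMonoOn (V m) (StrategicLearning.gammaRange p m) ∧
        Tendsto (V m) (atTop ⊓ 𝓟 (StrategicLearning.gammaRange p m)) (𝓝 p)) ∧
      (1 / 2 < p →
        (∀ m : ℕ, 2 ≤ m → StrictAntiOn (V m) (StrategicLearning.gammaRange p m)) ∧
        Tendsto (fun x : ℕ × ℝ => V x.1 x.2)
          (comap (fun x : ℕ × ℝ => x.2 ^ (x.1 - 2)) (𝓝 (StrategicLearning.kappa p)) ⊓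
            𝓟 {x : ℕ × ℝ | 2 ≤ x.1 ∧ x.2 ∈ StrategicLearning.gammaRange p x.1})
          (𝓝 1)) := by
  refine ⟨fun m x => StrategicLearning.senderLimit p (x ^ (m - 2)), fun m _ S _ E h =>
    StrategicLearning.isSenderLimit_senderLimit hp0 hp1 E h, fun hp m _ => ⟨?_, ?_⟩,
    fun hp => ⟨fun m _ => ?_, ?_⟩⟩
  · intro x hx y _ hxy
    have h := StrategicLearning.gammaRange_pow_lt hp0 hp1 hx hxy
    simp only [StrategicLearning.senderLimit]
    rw [div_eq_mul_one_div, div_eq_mul_one_div (2 * p - 1) (y ^ (m - 2) - 1)]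
    nlinarith
  · rcases eq_or_ne (m - 2) 0 with h0 | h0
    · have : StrategicLearning.gammaRange p m = ∅ := Set.eq_empty_of_forall_notMem fun x hx =>
        (StrategicLearning.gammaRange_pow hp0 hp1 hx).1 h0
      simp [this]
    · refine Tendsto.mono_left ?_ inf_le_left
      have h1 : Tendsto (fun x : ℝ => x ^ (m - 2) - 1) atTop atTop :=
        tendsto_atTop_add_const_right _ _ (tendsto_pow_atTop h0)
      simpa [StrategicLearning.senderLimit] using
        (h1.const_div_atTop (2 * p - 1)).const_add p
  · intro x hx y _ hxy
    have h := StrategicLearning.gammaRange_pow_lt hp0 hp1 hx hxy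
    simp only [StrategicLearning.senderLimit]
    rw [div_eq_mul_one_div, div_eq_mul_one_div (2 * p - 1) (x ^ (m - 2) - 1)]
    nlinarith
  -- The payoff depends on `(m, γ)` through `Γ` alone and is continuous at `κ`, since `κ > 1` for `p
  -- > 1 / 2`. The limit is therefore its value at `κ`, even with `m` varying.
  · refine Tendsto.mono_left ?_ inf_le_left
    have hq : 0 < 1 - p := by linarith
    have h2 : 0 < 2 * p - 1 := by linarith
    have hκ : StrategicLearning.kappa p = p / (1 - p) := by
      refine max_eq_left ?_
      rw [div_le_div_iff₀ hp0 hq]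
      nlinarith
    have hκ1 : StrategicLearning.kappa p - 1 = (2 * p - 1) / (1 - p) := by
      rw [hκ]; field_simp; ring
    have hcont : ContinuousAt (StrategicLearning.senderLimit p) (StrategicLearning.kappa p) := by
      unfold StrategicLearning.senderLimit
      refine continuousAt_const.add (continuousAt_const.div (by fun_prop) ?_)
      rw [hκ1]
      positivity
    have hval : StrategicLearning.senderLimit p (StrategicLearning.kappa p) = 1 := by
      rw [StrategicLearning.senderLimit, hκ1, div_div_cancel₀ h2.ne']
      ring
    have h3 : Tendsto (StrategicLearning.senderLimit p) (𝓝 (StrategicLearning.kappa p)) (𝓝 1) := by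
      have := hcont.tendsto
      rwa [hval] at this
    exact h3.comp tendsto_comap
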